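/- Let $\mathcal{X},\mathcal{Y}$ be finite sets, let $\mathcal{S}$ be a nonempty set of probability mass functions on $\mathcal{X}\times\mathcal{Y}$, and let $\mathbf{d}=\{(\underline d_n,\overline d_n)\}_{n\ge 1}$ be integers with $-n\le \underline d_n\le \overline d_n\le n$. For $P\in\mathcal{S}$ let $(X_t,Y_t)$, $t\in\mathbb{Z}$, be i.i.d. pairs with law $P$. For an integer $d$ put $X^n=(X_1,\dots,X_n)$ and $Y^n_{(d)}=(Y_{1+d},\dots,Y_{n+d})$. A code of blocklength $n$ consists of positive integers $M_n^{(1)},M_n^{(2)}$ and maps $f_n^{(1)}:\mathcal{X}^n\to\{1,\dots,M_n^{(1)}\}$, $f_n^{(2)}:\mathcal{Y}^n\to\{1,\dots,M_n^{(2)}\}$ and $\varphi_n:\{1,\dots,M_n^{(1)}\}\times\{1,\dots,M_n^{(2)}\}\to\mathcal{X}^n\times\mathcal{Y}^n$. A pair $(R_1,R_2)$ of real numbers is achievable for $\mathcal{S}$ and $\mathbf{d}$ if there is a sequence of codes (which may depend on $\mathcal{S}$ and $\mathbf{d}$, but not on $P\in\mathcal{S}$ or on the actual delay $d$) such that $$\limsup_{n\to\infty}\frac1n\log_2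 M_n^{(i)}\le R_i\quad(i=1,2),$$ $$\lim_{n\to\infty}\ \sup_{P\in\mathcal{S}}\ \max_{\underline d_n\le d\le\overline d_n}\Pr\bigl\{\varphi_n\bigl(f_n^{(1)}(X^n),f_n^{(2)}(Y^n_{(d)})\bigr)\ne (X^n,Y^n_{(d)})\bigr\}=0 .$$ Let $\mathcal{R}_{\mathbf{d}}(\mathcal{S})$ be the set of all achievable pairs, and let $\Delta_{\mathbf{d}}=\limsup_{n\to\infty}\max\{|\overline d_n|,|\underline d_n|\}/n$. Then $$\mathcal{R}_{\mathbf{d}}(\mathcal{S})=\Bigl\{(R_1,R_2)\in\mathbb{R}^2:\ R_i\ge\sup_{P\in\mathcal{S}}\bigl(H_i(X,Y)+\Delta_{\mathbf{d}}\,I(X;Y)\bigr)\ \text{ for } i=1,2,3\Bigr\},$$ where $R_3=R_1+R_2$, $H_1(X,Y)=H(X|Y)$, $H_2(X,Y)=H(Y|X)$, $H_3(X,Y)=H(X,Y)$, and the entropies and the mutual information $I(X;Y)$ are those, in bits, of a pair $(X,Y)$ with law $P$. -/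

import Mathlib

open Filter Topology MeasureTheory
open scoped ENNReal

namespace AsyncSW

noncomputable section

/-! Information measures, in bits, of a pair `(X, Y)` with joint PMF `P` on `α × β`. -/

/-- The joint probability `P_{XY}(x, y)` as a real number. -/
def joint {α β : Type*} (P : PMF (α × β)) (x : α) (y : β) : ℝ :=
  (P (x, y)).toReal

/-- The marginal `P_X(x)`. -/
def margX {α β : Type*} [Fintype β] (P : PMF (α × β)) (x : α) : ℝ :=
  ∑ y, joint P x y

/-- The marginal `P_Y(y)`. -/
def margY {α β : Type*} [Fintype α] (P : PMF (α × β)) (y : β) : ℝ :=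
  ∑ x, joint P x y

/-- The joint entropy `H(X, Y)`; terms of probability zero vanish. -/
def jointEntropy {α β : Type*} [Fintype α] [Fintype β] (P : PMF (α × β)) : ℝ :=
  -∑ x, ∑ y, joint P x y * Real.logb 2 (joint P x y)

/-- The conditional entropy `H(X | Y)`. -/
def condEntropyXY {α β : Type*} [Fintype α] [Fintype β] (P : PMF (α × β)) : ℝ :=
  -∑ x, ∑ y, joint P x y * Real.logb 2 (joint P x y / margY P y)

/-- The conditional entropy `H(Y | X)`. -/
def condEntropyYX {α β : Type*} [Fintype α] [Fintype β] (P : PMF (α × β)) : ℝ :=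
  -∑ x, ∑ y, joint P x y * Real.logb 2 (joint P x y / margX P x)

/-- The mutual information `I(X; Y)`. -/
def mutualInfo {α β : Type*} [Fintype α] [Fintype β] (P : PMF (α × β)) : ℝ :=
  ∑ x, ∑ y, joint P x y * Real.logb 2 (joint P x y / (margX P x * margY P y))

/-- A Slepian–Wolf code of blocklength `n`: two separate encoders and one decoder. -/
structure Code (α β : Type*) (n : ℕ) where
  /-- The number of codewords of encoder 1. -/
  M₁ : ℕ
  /-- The number of codewords of encoder 2. -/
  M₂ : ℕ
  M₁_pos : 0 < M₁
  M₂_pos : 0 < M₂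
  /-- Encoder 1. -/
  enc₁ : (Fin n → α) → Fin M₁
  /-- Encoder 2. -/
  enc₂ : (Fin n → β) → Fin M₂
  /-- The decoder. -/
  dec : Fin M₁ × Fin M₂ → (Fin n → α) × (Fin n → β)

/-- The rate `(1/n) log M₁` of encoder 1, in bits per symbol. -/
def Code.rate₁ {α β : Type*} {n : ℕ} (C : Code α β n) : ℝ :=
  Real.logb 2 C.M₁ / n

/-- The rate `(1/n) log M₂` of encoder 2, in bits per symbol. -/
def Code.rate₂ {α β : Type*} {n : ℕ} (C : Code α β n) : ℝ :=
  Real.logb 2 C.M₂ / n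

/-- The block `X^n = (X_1, …, X_n)` of a two-sided sequence `ω = (X_t, Y_t)_{t ∈ ℤ}`. -/
def blockX {α β : Type*} (n : ℕ) (ω : ℤ → α × β) : Fin n → α :=
  fun i => (ω (1 + (i : ℤ))).1

/-- The delayed block `(Y_{1+d}, …, Y_{n+d})` of `ω = (X_t, Y_t)_{t ∈ ℤ}`. -/
def blockY {α β : Type*} (n : ℕ) (d : ℤ) (ω : ℤ → α × β) : Fin n → β :=
  fun i => (ω (1 + (i : ℤ) + d)).2

/-- The probability that the decoder does not recover the pair of blocks, when the pairs
`(X_t, Y_t)`, `t ∈ ℤ`, are i.i.d. with PMF `P` and the relative delay is `d`. -/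
def Code.errorProb {α β : Type*} {n : ℕ} (C : Code α β n) (P : PMF (α × β)) (d : ℤ) : ℝ≥0∞ :=
  letI : MeasurableSpace (α × β) := ⊤
  (Measure.infinitePi fun _ : ℤ => P.toMeasure)
    {ω | C.dec (C.enc₁ (blockX n ω), C.enc₂ (blockY n d ω)) ≠ (blockX n ω, blockY n d ω)}

/-- `(R₁, R₂)` is achievable for the set `S` of PMFs and the delay bounds `dmin n ≤ d ≤ dmax n`.
One sequence of codes has to serve all `P ∈ S` and all possible delays. -/
def Achievable {α β : Type*} (S : Set (PMF (α × β))) (dmin dmax : ℕ → ℤ) (R₁ R₂ : ℝ) : Prop :=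
  ∃ C : ∀ n : ℕ, Code α β n,
    limsup (fun n => ((C n).rate₁ : EReal)) atTop ≤ (R₁ : EReal) ∧
    limsup (fun n => ((C n).rate₂ : EReal)) atTop ≤ (R₂ : EReal) ∧
    Tendsto (fun n => ⨆ P ∈ S, ⨆ d ∈ Set.Icc (dmin n) (dmax n), (C n).errorProb P d)
      atTop (𝓝 0)

/-- The achievable rate region. -/
def achievableRateRegion {α β : Type*} (S : Set (PMF (α × β))) (dmin dmax : ℕ → ℤ) :
    Set (ℝ × ℝ) :=
  {R | Achievable S dmin dmax R.1 R.2}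

/-- The asymptotic maximal relative delay `limsup max(|dmax n|, |dmin n|) / n`. -/
def delayRatio (dmin dmax : ℕ → ℤ) : ℝ :=
  limsup (fun n : ℕ => max |(dmax n : ℝ)| |(dmin n : ℝ)| / (n : ℝ)) atTop

end

end AsyncSW

/-!
The delayed blocks `X^n` and `Y^n_(d)` overlap in `n - |d|` source times. The other `|d|` letters
of each block are independent of the other block, so the joint entropy and both conditional
entropies of the pair of blocks exceed those of synchronized blocks by `|d| I(X; Y)` bits
(`sum_window_partialEntropy`). The three conditions of the theorem differ only in which of the
two sources is given as side information. A pair `(u, v)` of Booleans records this choice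
throughout: the conditional probability of a block pair `z` is
`blockLaw z / partialMass blockLaw u v z`, and it factors over the times seen by at least one
encoder (`partialMass_blockLaw`). Hence its negative logarithm is a sum of independent terms,
which concentrates around its mean by Chebyshev's inequality (`sourceProb_chebyshev`).

Converse. Given the side information, a code recovers at most as many pairs as there are
codewords left, so it recovers pairs of conditional probability at most `1 / K` with probability
at most (number of codewords) `/ K` (`sum_correct_le`). Combined with the concentration, applied
to the extreme delay of larger modulus, this gives the bounds (`le_freeRate_of_codes`).

Direct part. One code has to serve all sources and delays. The distributions proportional to
`m + 1`, with integers `0 ≤ m ≤ n`, form a grid of polynomial size, and every distribution `P` is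
at most `1 + O(1 / n)` times a grid distribution `Q` whose masses are at least of order `1 / n`
(`exists_gridPMF`). Consequently the block law of `P` is at most a constant times that of `Q`,
and the information density with respect to `Q` has logarithmically bounded terms and a mean
that exceeds the entropy under `P` by a constant at most (`sum_mass_mul_letterInfo_le`). Let `T`
be the set of block pairs whose conditional probabilities exceed given thresholds under some
grid distribution and some delay. Its sections are exponentially small compared to the numbers
of codewords, so random binning with a decoder that looks for a member of `T` works on average
under the sum of all grid laws (`exists_code_of_laws`), hence on `T` for all sources and delays at
the same time. Outside `T`, Chebyshev's inequality applies uniformly in the source. A diagonal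
choice removes the slack in the rates (`exists_seq_of_eventually`).
-/

open ProbabilityTheory

namespace AsyncSW

noncomputable section

/-! ### Probabilities of the i.i.d. source -/

/-- The probability mass `P z` as a real number. -/
def mass {Z : Type*} (P : PMF Z) (z : Z) : ℝ := (P z).toReal

lemma mass_nonneg {Z : Type*} (P : PMF Z) (z : Z) : 0 ≤ mass P z := ENNReal.toReal_nonneg

lemma sum_mass {Z : Type*} [Fintype Z] (P : PMF Z) : ∑ z, mass P z = 1 := by
  unfold mass
  rw [← ENNReal.toReal_sum (fun z _ => P.apply_ne_top z), ← tsum_fintype (L := .unconditional Z),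
    P.tsum_coe, ENNReal.toReal_one]

lemma mass_le_one {Z : Type*} (P : PMF Z) (z : Z) : mass P z ≤ 1 :=
  ENNReal.toReal_le_of_le_ofReal zero_le_one (by simpa using P.coe_le_one z)

/-- A real-valued version of the law of a two-sided i.i.d. sequence with letter distribution
`P`; all subsets of the alphabet are measurable, as in `Code.errorProb`. -/
def sourceProb {Z : Type*} (P : PMF Z) (E : Set (ℤ → Z)) : ℝ :=
  letI : MeasurableSpace Z := ⊤
  ((Measure.infinitePi fun _ : ℤ => P.toMeasure) E).toReal

section
variable {Z : Type*} (P : PMF Z)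

lemma sourceProb_nonneg (E : Set (ℤ → Z)) : 0 ≤ sourceProb P E := ENNReal.toReal_nonneg

lemma sourceProb_univ : sourceProb P Set.univ = 1 := by
  simp [sourceProb]

lemma sourceProb_mono {E F : Set (ℤ → Z)} (h : E ⊆ F) : sourceProb P E ≤ sourceProb P F :=
  ENNReal.toReal_mono (measure_ne_top _ _) (measure_mono h)

lemma sourceProb_union_le (E F : Set (ℤ → Z)) :
    sourceProb P (E ∪ F) ≤ sourceProb P E + sourceProb P F := by
  unfold sourceProb
  rw [← ENNReal.toReal_add (measure_ne_top _ _) (measure_ne_top _ _)]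
  exact ENNReal.toReal_mono (by simp) (measure_union_le _ _)

/-- The coordinates of the source are independent, so a box has product probability. -/
lemma sourceProb_box [Fintype Z] (U : Finset ℤ) (s : ℤ → Finset Z) :
    sourceProb P {ω | ∀ t ∈ U, ω t ∈ s t} = ∏ t ∈ U, ∑ z ∈ s t, mass P z := by
  let _ : MeasurableSpace Z := ⊤
  have : DiscreteMeasurableSpace Z := ⟨fun _ => trivial⟩
  have h := Measure.infinitePi_pi (μ := fun _ : ℤ => P.toMeasure) (s := U)
    (t := fun t => (s t : Set Z)) (fun _ _ => MeasurableSet.of_discrete)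
  have hE : {ω : ℤ → Z | ∀ t ∈ U, ω t ∈ s t} = Set.pi (U : Set ℤ) (fun t => (s t : Set Z)) := by
    ext ω; simp [Set.mem_pi]
  change ((Measure.infinitePi fun _ : ℤ => P.toMeasure) _).toReal = _
  rw [hE, h, ENNReal.toReal_prod]
  refine Finset.prod_congr rfl fun t _ => ?_
  rw [PMF.toMeasure_apply_finset, ENNReal.toReal_sum (fun z _ => P.apply_ne_top z)]
  rfl

/-- The law of a finite-valued function of the source that is measurable. -/
lemma sourceProb_preimage {W : Type*} [Finite W] (F : (ℤ → Z) → W)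
    (hF : ∀ w, @MeasurableSet _ (@MeasurableSpace.pi ℤ (fun _ => Z) fun _ => ⊤) {ω | F ω = w})
    (s : Finset W) :
    sourceProb P {ω | F ω ∈ s} = ∑ w ∈ s, sourceProb P {ω | F ω = w} := by
  let _ : MeasurableSpace Z := ⊤
  have hE : {ω | F ω ∈ s} = ⋃ w ∈ s, {ω | F ω = w} := by
    ext ω; simp
  change ((Measure.infinitePi fun _ : ℤ => P.toMeasure) _).toReal = _
  rw [hE, measure_biUnion_finset, ENNReal.toReal_sum (fun _ _ => measure_ne_top _ _)]
  · rfl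
  · intro a _ b _ hab
    refine Set.disjoint_left.2 fun ω h1 h2 => hab ?_
    exact h1.symm.trans h2
  · exact fun w _ => hF w

/-- Chebyshev's inequality for a sum of bounded functions of distinct source letters. -/
lemma sourceProb_chebyshev [Fintype Z] (U : Finset ℤ) (g : ℤ → Z → ℝ) {L : ℝ}
    (hL : ∀ t z, |g t z| ≤ L) {c : ℝ} (hc : 0 < c) :
    sourceProb P {ω | c ≤ |∑ t ∈ U, g t (ω t) - ∑ t ∈ U, ∑ z, mass P z * g t z|}
      ≤ U.card * L ^ 2 / c ^ 2 := by
  let _ : MeasurableSpace Z := ⊤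
  have : DiscreteMeasurableSpace Z := ⟨fun _ => trivial⟩
  set μ := Measure.infinitePi fun _ : ℤ => P.toMeasure with hμ
  have hmeas : ∀ t, Measurable fun ω : ℤ → Z => g t (ω t) := fun t =>
    (Measurable.of_discrete (f := g t)).comp (measurable_pi_apply t)
  have hmem : ∀ t, MemLp (fun ω : ℤ → Z => g t (ω t)) 2 μ := fun t =>
    MemLp.of_bound (hmeas t).aestronglyMeasurable L (Eventually.of_forall fun ω => hL t _)
  have hint : ∀ f : Z → ℝ, ∀ t, ∫ ω, f (ω t) ∂μ = ∑ z, mass P z * f z := by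
    intro f t
    have h1 := (measurePreserving_eval_infinitePi (fun _ : ℤ => P.toMeasure) t)
    have h2 := integral_map (μ := μ) (φ := fun ω : ℤ → Z => ω t) (f := f)
      (measurable_pi_apply t).aemeasurable
      (Measurable.of_discrete (f := f)).aestronglyMeasurable
    rw [← h2]
    change ∫ y, f y ∂(Measure.map (Function.eval t) μ) = _
    rw [h1.map_eq, PMF.integral_eq_sum]
    rfl
  have hindep : iIndepFun (fun (t : ℤ) (ω : ℤ → Z) => g t (ω t)) μ :=
    iIndepFun_infinitePi (fun t => Measurable.of_discrete)
  have hE : μ[fun ω => ∑ t ∈ U, g t (ω t)] = ∑ t ∈ U, ∑ z, mass P z * g t z := by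
    rw [integral_finsetSum _ (fun t _ => (hmem t).integrable (by norm_num))]
    exact Finset.sum_congr rfl fun t _ => hint _ _
  have hvar : Var[fun ω => ∑ t ∈ U, g t (ω t); μ] ≤ U.card * L ^ 2 := by
    have h1 := IndepFun.variance_sum (μ := μ) (X := fun (t : ℤ) (ω : ℤ → Z) => g t (ω t)) (s := U)
      (fun t _ => hmem t) (fun i _ j _ hij => hindep.indepFun hij)
    have h2 : (∑ t ∈ U, fun ω : ℤ → Z => g t (ω t)) = fun ω => ∑ t ∈ U, g t (ω t) := by
      ext ω; simp
    rw [← h2, h1, ← nsmul_eq_mul, ← Finset.sum_const]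
    refine Finset.sum_le_sum fun t _ => ?_
    refine (variance_le_expectation_sq (hmeas t).aestronglyMeasurable).trans ?_
    have h3 := hint (fun z => g t z ^ 2) t
    change ∫ ω, (g t (ω t)) ^ 2 ∂μ ≤ _
    rw [h3]
    calc ∑ z, mass P z * g t z ^ 2 ≤ ∑ z, mass P z * L ^ 2 :=
          Finset.sum_le_sum fun z _ => mul_le_mul_of_nonneg_left
            (sq_le_sq' (neg_le_of_abs_le (hL t z)) (le_of_abs_le (hL t z))) (mass_nonneg P z)
      _ = L ^ 2 := by rw [← Finset.sum_mul, sum_mass, one_mul]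
  have hm : MemLp (fun ω : ℤ → Z => ∑ t ∈ U, g t (ω t)) 2 μ := memLp_finsetSum _ fun t _ => hmem t
  have hch := meas_ge_le_variance_div_sq hm hc
  rw [hE] at hch
  change (μ _).toReal ≤ _
  refine ENNReal.toReal_le_of_le_ofReal (by positivity) (hch.trans ?_)
  exact ENNReal.ofReal_le_ofReal (by gcongr)

end

/-! ### Partial agreement and partial masses -/

open scoped Classical in
/-- The points that agree with `z` in the first coordinate if `u` holds and in the second
coordinate if `v` holds. The pair `(u, v)` says which of the two sources is given. -/
def agreeSet {A B : Type*} [Fintype A] [Fintype B] (u v : Bool) (z : A × B) : Finset (A × B) :=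
  Finset.univ.filter fun w => (u = true → w.1 = z.1) ∧ (v = true → w.2 = z.2)

/-- The mass of the points that agree with `z` in the coordinates selected by `(u, v)`:
`q_{XY}(z)`, `q_X(z.1)`, `q_Y(z.2)` or the total mass. -/
def partialMass {A B : Type*} [Fintype A] [Fintype B] (q : A × B → ℝ) (u v : Bool)
    (z : A × B) : ℝ := ∑ w ∈ agreeSet u v z, q w

section
variable {A B : Type*} [Fintype A] [Fintype B]

lemma mem_agreeSet {u v : Bool} {z w : A × B} :
    w ∈ agreeSet u v z ↔ (u = true → w.1 = z.1) ∧ (v = true → w.2 = z.2) := by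
  simp [agreeSet]

lemma mem_agreeSet_comm {u v : Bool} {z w : A × B} :
    w ∈ agreeSet u v z ↔ z ∈ agreeSet u v w := by
  simp only [mem_agreeSet, eq_comm]

lemma agreeSet_eq_of_mem {u v : Bool} {z w : A × B} (h : w ∈ agreeSet u v z) :
    agreeSet u v w = agreeSet u v z := by
  rw [mem_agreeSet] at h
  ext p
  rw [mem_agreeSet, mem_agreeSet]
  constructor
  · exact fun hp => ⟨fun hu => (hp.1 hu).trans (h.1 hu), fun hv => (hp.2 hv).trans (h.2 hv)⟩
  · exact fun hp => ⟨fun hu => (hp.1 hu).trans (h.1 hu).symm,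
      fun hv => (hp.2 hv).trans (h.2 hv).symm⟩

lemma self_mem_agreeSet (u v : Bool) (z : A × B) : z ∈ agreeSet u v z := by
  simp [mem_agreeSet]

lemma agreeSet_true_true (z : A × B) : agreeSet true true z = {z} := by
  ext w; simp [mem_agreeSet, Prod.ext_iff]

lemma partialMass_true_true (q : A × B → ℝ) (z : A × B) : partialMass q true true z = q z := by
  rw [partialMass, agreeSet_true_true, Finset.sum_singleton]

lemma partialMass_false_false (q : A × B → ℝ) (z : A × B) :
    partialMass q false false z = ∑ w, q w := by
  rw [partialMass]; congr 1; ext w; simp [mem_agreeSet]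

lemma partialMass_true_false (q : A × B → ℝ) (z : A × B) :
    partialMass q true false z = ∑ y, q (z.1, y) := by
  classical
  rw [partialMass]
  symm
  refine Finset.sum_bij (fun y _ => (z.1, y)) ?_ ?_ ?_ ?_
  · intro y _; simp [mem_agreeSet]
  · intro a _ b _ h; simpa using h
  · rintro ⟨a, b⟩ h
    simp only [mem_agreeSet, Bool.false_eq_true, false_implies, and_true, forall_const] at h
    exact ⟨b, Finset.mem_univ _, by rw [← h]⟩
  · intros; rfl

lemma partialMass_false_true (q : A × B → ℝ) (z : A × B) :
    partialMass q false true z = ∑ x, q (x, z.2) := by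
  classical
  rw [partialMass]
  symm
  refine Finset.sum_bij (fun x _ => (x, z.2)) ?_ ?_ ?_ ?_
  · intro y _; simp [mem_agreeSet]
  · intro a _ b _ h; simpa using h
  · rintro ⟨a, b⟩ h
    simp only [mem_agreeSet, Bool.false_eq_true, false_implies, true_and, forall_const] at h
    exact ⟨a, Finset.mem_univ _, by rw [← h]⟩
  · intros; rfl

lemma partialMass_nonneg {q : A × B → ℝ} (hq : ∀ z, 0 ≤ q z) (u v : Bool) (z : A × B) :
    0 ≤ partialMass q u v z := Finset.sum_nonneg fun w _ => hq w

lemma le_partialMass {q : A × B → ℝ} (hq : ∀ z, 0 ≤ q z) (u v : Bool) (z : A × B) :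
    q z ≤ partialMass q u v z :=
  Finset.single_le_sum (f := q) (fun w _ => hq w) (self_mem_agreeSet u v z)

/-- The fewer coordinates are selected, the larger is the partial mass. -/
lemma partialMass_anti {q : A × B → ℝ} (hq : ∀ z, 0 ≤ q z) (a b u v : Bool) (z : A × B) :
    partialMass q a b z ≤ partialMass q (u && a) (v && b) z := by
  refine Finset.sum_le_sum_of_subset_of_nonneg (fun w => ?_) fun w _ _ => hq w
  simp only [mem_agreeSet, Bool.and_eq_true]
  tauto

lemma partialMass_mono {q r : A × B → ℝ} {c : ℝ} (h : ∀ z, q z ≤ c * r z) (u v : Bool)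
    (z : A × B) : partialMass q u v z ≤ c * partialMass r u v z := by
  rw [partialMass, partialMass, Finset.mul_sum]
  exact Finset.sum_le_sum fun w _ => h w

lemma partialMass_le_one {q : A × B → ℝ} (hq : ∀ z, 0 ≤ q z) (h1 : ∑ z, q z = 1) (u v : Bool)
    (z : A × B) : partialMass q u v z ≤ 1 := by
  rw [← h1]
  exact Finset.sum_le_univ_sum_of_nonneg hq

end

/-! ### The law of the pair of blocks -/

section
variable {α β : Type*}

/-- The pair of blocks `(X^n, Y^n_(d))` cut out of a two-sided sequence. -/
def block (n : ℕ) (d : ℤ) (ω : ℤ → α × β) : (Fin n → α) × (Fin n → β) :=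
  (blockX n ω, blockY n d ω)

/-- The times `1, …, n` seen by encoder 1. -/
def windowX (n : ℕ) : Finset ℤ := Finset.Icc 1 n

/-- The times `1 + d, …, n + d` seen by encoder 2. -/
def windowY (n : ℕ) (d : ℤ) : Finset ℤ := Finset.Icc (1 + d) (n + d)

/-- The times seen by at least one of the encoders. -/
def window (n : ℕ) (d : ℤ) : Finset ℤ := windowX n ∪ windowY n d

lemma blockX_eq_iff {n : ℕ} {ω ω' : ℤ → α × β} :
    blockX n ω' = blockX n ω ↔ ∀ t ∈ windowX n, (ω' t).1 = (ω t).1 := by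
  constructor
  · intro h t ht
    simp only [windowX, Finset.mem_Icc] at ht
    have := congrFun h ⟨(t - 1).toNat, by omega⟩
    simp only [blockX] at this
    rwa [show (1 + (((t - 1).toNat : ℕ) : ℤ)) = t by omega] at this
  · intro h
    funext i
    refine h _ ?_
    simp only [windowX, Finset.mem_Icc]
    omega

lemma blockY_eq_iff {n : ℕ} {d : ℤ} {ω ω' : ℤ → α × β} :
    blockY n d ω' = blockY n d ω ↔ ∀ t ∈ windowY n d, (ω' t).2 = (ω t).2 := by
  constructor
  · intro h t ht
    simp only [windowY, Finset.mem_Icc] at ht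
    have := congrFun h ⟨(t - 1 - d).toNat, by omega⟩
    simp only [blockY] at this
    rwa [show (1 + (((t - 1 - d).toNat : ℕ) : ℤ) + d) = t by omega] at this
  · intro h
    funext i
    refine h _ ?_
    simp only [windowY, Finset.mem_Icc]
    omega

lemma block_mem_agreeSet_iff [Fintype α] [Fintype β] {n : ℕ} {d : ℤ} {u v : Bool}
    {ω ω' : ℤ → α × β} :
    block n d ω' ∈ agreeSet u v (block n d ω) ↔
      ∀ t ∈ window n d,
        ω' t ∈ agreeSet (u && decide (t ∈ windowX n)) (v && decide (t ∈ windowY n d)) (ω t) := by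
  simp only [mem_agreeSet, block, blockX_eq_iff, blockY_eq_iff, window, Finset.mem_union,
    Bool.and_eq_true, decide_eq_true_eq]
  constructor
  · exact fun h t _ => ⟨fun hu => h.1 hu.1 t hu.2, fun hv => h.2 hv.1 t hv.2⟩
  · exact fun h => ⟨fun hu t ht => (h t (Or.inl ht)).1 ⟨hu, ht⟩,
      fun hv t ht => (h t (Or.inr ht)).2 ⟨hv, ht⟩⟩

/-- The joint law of `(X^n, Y^n_(d))` for the source `P`. -/
def blockLaw (P : PMF (α × β)) (n : ℕ) (d : ℤ) (z : (Fin n → α) × (Fin n → β)) : ℝ :=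
  sourceProb P {ω | block n d ω = z}

lemma blockLaw_nonneg (P : PMF (α × β)) (n : ℕ) (d : ℤ) (z : (Fin n → α) × (Fin n → β)) :
    0 ≤ blockLaw P n d z := sourceProb_nonneg _ _

variable [Fintype α] [Fintype β] (P : PMF (α × β)) (n : ℕ) (d : ℤ)

lemma sourceProb_block (s : Finset ((Fin n → α) × (Fin n → β))) :
    sourceProb P {ω | block n d ω ∈ s} = ∑ z ∈ s, blockLaw P n d z := by
  refine sourceProb_preimage P (block n d) (fun z => ?_) s
  let _ : MeasurableSpace (α × β) := ⊤
  have hm : ∀ t, Measurable fun ω : ℤ → α × β => ω t := fun t => measurable_pi_apply t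
  have : {ω : ℤ → α × β | block n d ω = z} =
      (⋂ i : Fin n, (fun ω : ℤ → α × β => ω (1 + (i : ℤ))) ⁻¹' {p | p.1 = z.1 i}) ∩
      (⋂ i : Fin n, (fun ω : ℤ → α × β => ω (1 + (i : ℤ) + d)) ⁻¹' {p | p.2 = z.2 i}) := by
    ext ω
    simp [block, Prod.ext_iff, funext_iff, blockX, blockY]
  rw [this]
  exact (MeasurableSet.iInter fun i => hm _ trivial).inter
    (MeasurableSet.iInter fun i => hm _ trivial)

lemma sum_blockLaw : ∑ z, blockLaw P n d z = 1 := by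
  rw [← sourceProb_block]; simp [sourceProb_univ]

/-- The partial masses of the block law factor over the times in the window. -/
lemma partialMass_blockLaw (u v : Bool) (ω : ℤ → α × β) :
    partialMass (blockLaw P n d) u v (block n d ω) =
      ∏ t ∈ window n d, partialMass (mass P)
        (u && decide (t ∈ windowX n)) (v && decide (t ∈ windowY n d)) (ω t) := by
  rw [partialMass, ← sourceProb_block]
  simp only [block_mem_agreeSet_iff]
  exact sourceProb_box P _ _

lemma blockLaw_block (ω : ℤ → α × β) :
    blockLaw P n d (block n d ω) =
      ∏ t ∈ window n d, partialMass (mass P)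
        (decide (t ∈ windowX n)) (decide (t ∈ windowY n d)) (ω t) := by
  rw [← partialMass_true_true (blockLaw P n d), partialMass_blockLaw]
  simp

/-- A source that dominates another one letter by letter dominates it on blocks. -/
lemma blockLaw_le {Q : PMF (α × β)} {c : ℝ} (hc : 0 ≤ c) (h : ∀ z, mass P z ≤ c * mass Q z)
    (z : (Fin n → α) × (Fin n → β)) :
    blockLaw P n d z ≤ c ^ (window n d).card * blockLaw Q n d z := by
  by_cases hz : ∃ ω : ℤ → α × β, block n d ω = z
  · obtain ⟨ω, rfl⟩ := hz
    rw [blockLaw_block, blockLaw_block, ← Finset.prod_const, ← Finset.prod_mul_distrib]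
    exact Finset.prod_le_prod (fun t _ => partialMass_nonneg (mass_nonneg P) _ _ _)
      fun t _ => partialMass_mono h _ _ _
  · have : {ω : ℤ → α × β | block n d ω = z} = ∅ := by
      ext ω; simpa using fun h => hz ⟨ω, h⟩
    have h0 : blockLaw P n d z = 0 := by rw [blockLaw, this]; simp [sourceProb]
    rw [h0]
    exact mul_nonneg (pow_nonneg hc _) (blockLaw_nonneg _ _ _ _)

lemma card_windowX : (windowX n).card = n := by simp [windowX]

lemma card_windowY : (windowY n d).card = n := by
  rw [windowY, Int.card_Icc]; omega

lemma card_window_le : (window n d).card ≤ 2 * n := by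
  refine (Finset.card_union_le _ _).trans ?_
  rw [card_windowX, card_windowY, two_mul]

/-- The two windows overlap in `n - |d|` times. -/
lemma card_window_inter {n : ℕ} {d : ℤ} (hd : |d| ≤ n) :
    ((windowX n ∩ windowY n d).card : ℝ) = n - |(d : ℝ)| := by
  have h1 : windowX n ∩ windowY n d = Finset.Icc (max 1 (1 + d)) (min (n : ℤ) (n + d)) := by
    ext t; simp only [windowX, windowY, Finset.mem_inter, Finset.mem_Icc]; omega
  have h2 : ((windowX n ∩ windowY n d).card : ℤ) = n - |d| := by
    rw [h1, Int.card_Icc]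
    rcases abs_cases d with ⟨h, _⟩ | ⟨h, _⟩ <;> omega
  exact_mod_cast h2

end

/-! ### Entropies -/

/-- Gibbs' inequality: if the likelihood ratio `ρ` has mean at most one, then `log ρ` has
nonpositive mean. -/
lemma sum_mul_logb_nonpos {Z : Type*} [Fintype Z] {p ρ : Z → ℝ} (hp : ∀ z, 0 ≤ p z)
    (h1 : ∑ z, p z = 1) (hρ : ∀ z, 0 < p z → 0 < ρ z) (h : ∑ z, p z * ρ z ≤ 1) :
    ∑ z, p z * Real.logb 2 (ρ z) ≤ 0 := by
  have h2 : ∑ z, p z * Real.log (ρ z) ≤ 0 := by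
    calc ∑ z, p z * Real.log (ρ z) ≤ ∑ z, (p z * ρ z - p z) := by
          refine Finset.sum_le_sum fun z _ => ?_
          rcases (hp z).eq_or_lt with h0 | h0
          · simp [← h0]
          · have := mul_le_mul_of_nonneg_left (Real.log_le_sub_one_of_pos (hρ z h0)) h0.le
            linarith
      _ ≤ 0 := by rw [Finset.sum_sub_distrib, h1]; linarith
  have h3 : ∑ z, p z * Real.logb 2 (ρ z) = (∑ z, p z * Real.log (ρ z)) / Real.log 2 := by
    rw [Finset.sum_div]
    exact Finset.sum_congr rfl fun z _ => by rw [Real.logb, mul_div_assoc]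
  rw [h3]
  exact div_nonpos_of_nonpos_of_nonneg h2 (Real.log_nonneg (by norm_num))

lemma mass_mk {α β : Type*} (P : PMF (α × β)) (x : α) (y : β) : mass P (x, y) = joint P x y := rfl

section
variable {α β : Type*} [Fintype α] [Fintype β]

/-- The entropy in bits of the coordinates selected by `(u, v)`: `H(X, Y)`, `H(X)`, `H(Y)`
or `0`. -/
def partialEntropy (P : PMF (α × β)) (u v : Bool) : ℝ :=
  ∑ z, mass P z * -Real.logb 2 (partialMass (mass P) u v z)

variable (P : PMF (α × β))

lemma partialMass_pos_of_mass_pos {z : α × β} (hz : 0 < mass P z) (u v : Bool) :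
    0 < partialMass (mass P) u v z :=
  hz.trans_le (le_partialMass (mass_nonneg P) u v z)

lemma partialEntropy_false_false : partialEntropy P false false = 0 := by
  simp [partialEntropy, partialMass_false_false, sum_mass]

lemma partialEntropy_nonneg (u v : Bool) : 0 ≤ partialEntropy P u v := by
  refine Finset.sum_nonneg fun z _ => mul_nonneg (mass_nonneg P z) ?_
  rw [neg_nonneg]
  exact Real.logb_nonpos (by norm_num) (partialMass_nonneg (mass_nonneg P) _ _ _)
    (partialMass_le_one (mass_nonneg P) (sum_mass P) _ _ _)

/-- A bound on the entropies that does not depend on the distribution. -/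
lemma partialEntropy_le (u v : Bool) :
    partialEntropy P u v ≤ Fintype.card (α × β) / Real.log 2 := by
  have hl : 0 < Real.log 2 := Real.log_pos (by norm_num)
  have : ∀ z, mass P z * -Real.logb 2 (partialMass (mass P) u v z) ≤ 1 / Real.log 2 := by
    intro z
    rcases (mass_nonneg P z).eq_or_lt with h0 | h0
    · rw [← h0]; simp [hl.le]
    · have h1 : Real.log (mass P z) ≤ Real.log (partialMass (mass P) u v z) :=
        Real.log_le_log h0 (le_partialMass (mass_nonneg P) u v z)
      have h2 := Real.one_sub_inv_le_log_of_pos h0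
      have h3 := mul_le_mul_of_nonneg_left (h2.trans h1) h0.le
      rw [mul_sub, mul_inv_cancel₀ h0.ne', mul_one] at h3
      rw [Real.logb, ← neg_div, mul_div_assoc']
      gcongr
      linarith
  calc partialEntropy P u v ≤ ∑ _z : α × β, 1 / Real.log 2 := Finset.sum_le_sum fun z _ => this z
    _ = _ := by rw [Finset.sum_const, Finset.card_univ, nsmul_eq_mul, mul_one_div]

lemma partialMass_margX (x : α) (y : β) :
    partialMass (mass P) true false (x, y) = margX P x := partialMass_true_false _ _

lemma partialMass_margY (x : α) (y : β) :
    partialMass (mass P) false true (x, y) = margY P y := partialMass_false_true _ _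

lemma partialEntropy_eq_sum (u v : Bool) : partialEntropy P u v =
    ∑ x, ∑ y, joint P x y * -Real.logb 2 (partialMass (mass P) u v (x, y)) := by
  rw [partialEntropy, Fintype.sum_prod_type]; rfl

lemma jointEntropy_eq : jointEntropy P = partialEntropy P true true := by
  rw [partialEntropy_eq_sum, jointEntropy]
  simp [partialMass_true_true, mass_mk]

lemma condEntropyXY_eq :
    condEntropyXY P = partialEntropy P true true - partialEntropy P false true := by
  rw [partialEntropy_eq_sum, partialEntropy_eq_sum, condEntropyXY]
  simp only [← Finset.sum_neg_distrib, ← Finset.sum_sub_distrib]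
  refine Finset.sum_congr rfl fun x _ => Finset.sum_congr rfl fun y _ => ?_
  rw [partialMass_true_true, partialMass_margY, mass_mk]
  rcases (mass_nonneg P (x, y)).eq_or_lt with h0 | h0
  · rw [mass_mk] at h0; simp [← h0]
  · have h1 := partialMass_pos_of_mass_pos P h0 false true
    rw [partialMass_margY] at h1
    rw [mass_mk] at h0
    rw [Real.logb_div h0.ne' h1.ne']; ring

lemma condEntropyYX_eq :
    condEntropyYX P = partialEntropy P true true - partialEntropy P true false := by
  rw [partialEntropy_eq_sum, partialEntropy_eq_sum, condEntropyYX]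
  simp only [← Finset.sum_neg_distrib, ← Finset.sum_sub_distrib]
  refine Finset.sum_congr rfl fun x _ => Finset.sum_congr rfl fun y _ => ?_
  rw [partialMass_true_true, partialMass_margX, mass_mk]
  rcases (mass_nonneg P (x, y)).eq_or_lt with h0 | h0
  · rw [mass_mk] at h0; simp [← h0]
  · have h1 := partialMass_pos_of_mass_pos P h0 true false
    rw [partialMass_margX] at h1
    rw [mass_mk] at h0
    rw [Real.logb_div h0.ne' h1.ne']; ring

lemma mutualInfo_eq : mutualInfo P =
    partialEntropy P true false + partialEntropy P false true - partialEntropy P true true := by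
  rw [partialEntropy_eq_sum, partialEntropy_eq_sum, partialEntropy_eq_sum, mutualInfo]
  simp only [← Finset.sum_add_distrib, ← Finset.sum_sub_distrib]
  refine Finset.sum_congr rfl fun x _ => Finset.sum_congr rfl fun y _ => ?_
  rw [partialMass_true_true, partialMass_margX, partialMass_margY, mass_mk]
  rcases (mass_nonneg P (x, y)).eq_or_lt with h0 | h0
  · rw [mass_mk] at h0; simp [← h0]
  · have h1 := partialMass_pos_of_mass_pos P h0 true false
    have h2 := partialMass_pos_of_mass_pos P h0 false true
    rw [partialMass_margX] at h1
    rw [partialMass_margY] at h2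
    rw [mass_mk] at h0
    rw [Real.logb_div h0.ne' (mul_pos h1 h2).ne', Real.logb_mul h1.ne' h2.ne']; ring

lemma sum_margX : ∑ x, margX P x = 1 := by
  rw [← sum_mass P, Fintype.sum_prod_type]; rfl

lemma sum_margY : ∑ y, margY P y = 1 := by
  rw [← sum_mass P, Fintype.sum_prod_type_right]; rfl

lemma mutualInfo_nonneg : 0 ≤ mutualInfo P := by
  have hX : ∀ x, 0 ≤ margX P x := fun x => Finset.sum_nonneg fun _ _ => mass_nonneg P _
  have hY : ∀ y, 0 ≤ margY P y := fun y => Finset.sum_nonneg fun _ _ => mass_nonneg P _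
  have h := sum_mul_logb_nonpos (p := mass P)
    (ρ := fun z => margX P z.1 * margY P z.2 / mass P z) (mass_nonneg P) (sum_mass P) ?_ ?_
  · have h2 : mutualInfo P =
        -∑ z, mass P z * Real.logb 2 (margX P z.1 * margY P z.2 / mass P z) := by
      rw [mutualInfo, Fintype.sum_prod_type]
      simp only [← Finset.sum_neg_distrib]
      refine Finset.sum_congr rfl fun x _ => Finset.sum_congr rfl fun y _ => ?_
      rw [mass_mk, ← inv_div, Real.logb_inv]; ring
    rw [h2]; linarith
  · rintro ⟨x, y⟩ h0
    have h1 := partialMass_pos_of_mass_pos P h0 true false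
    have h2 := partialMass_pos_of_mass_pos P h0 false true
    rw [partialMass_margX] at h1
    rw [partialMass_margY] at h2
    positivity
  · calc ∑ z, mass P z * (margX P z.1 * margY P z.2 / mass P z)
        ≤ ∑ z : α × β, margX P z.1 * margY P z.2 := by
          refine Finset.sum_le_sum fun z _ => ?_
          rcases (mass_nonneg P z).eq_or_lt with h0 | h0
          · rw [← h0, zero_mul]; exact mul_nonneg (hX _) (hY _)
          · rw [mul_div_cancel₀ _ h0.ne']
      _ = 1 := by
          rw [Fintype.sum_prod_type]
          simp only [← Finset.mul_sum, sum_margY, mul_one, sum_margX]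

lemma mutualInfo_le : mutualInfo P ≤ 2 * (Fintype.card (α × β) / Real.log 2) := by
  have h1 := partialEntropy_le P true false
  have h2 := partialEntropy_le P false true
  have h3 := partialEntropy_nonneg P true true
  rw [mutualInfo_eq]; linarith

/-- The mean under `P` of the likelihood ratio of partial masses is at most one. -/
lemma sum_mass_mul_partialMass_div_le (Q : PMF (α × β)) (u v : Bool) :
    ∑ z, mass P z * (partialMass (mass Q) u v z / partialMass (mass P) u v z) ≤ 1 := by
  classical
  calc ∑ z, mass P z * (partialMass (mass Q) u v z / partialMass (mass P) u v z)
      = ∑ z, ∑ w, if w ∈ agreeSet u v z then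
          mass Q w * (mass P z / partialMass (mass P) u v w) else 0 := by
        refine Finset.sum_congr rfl fun z _ => ?_
        rw [← Finset.sum_filter, partialMass, Finset.sum_div, Finset.mul_sum,
          Finset.filter_mem_eq_inter, Finset.univ_inter]
        refine Finset.sum_congr rfl fun w hw => ?_
        rw [partialMass, partialMass, agreeSet_eq_of_mem hw]; ring
    _ = ∑ w, ∑ z, if z ∈ agreeSet u v w then
          mass Q w * (mass P z / partialMass (mass P) u v w) else 0 := by
        rw [Finset.sum_comm]
        simp only [mem_agreeSet_comm]
    _ ≤ ∑ w, mass Q w := by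
        refine Finset.sum_le_sum fun w _ => ?_
        rw [← Finset.sum_filter, Finset.filter_mem_eq_inter, Finset.univ_inter, ← Finset.mul_sum,
          ← Finset.sum_div]
        exact mul_le_of_le_one_right (mass_nonneg Q w) (div_self_le_one _)
    _ = 1 := sum_mass Q

/-! ### The information density of the blocks -/

/-- The information carried by the letter at time `t` beyond the part of it that is given by
the side information `(u, v)`, as measured by the distribution `Q`. -/
def letterInfo (Q : PMF (α × β)) (n : ℕ) (d : ℤ) (u v : Bool) (t : ℤ) (z : α × β) : ℝ :=
  -Real.logb 2 (partialMass (mass Q) (decide (t ∈ windowX n)) (decide (t ∈ windowY n d)) z /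
    partialMass (mass Q) (u && decide (t ∈ windowX n)) (v && decide (t ∈ windowY n d)) z)

/-- The conditional information density of the blocks is a sum over the times in the window. -/
lemma sum_letterInfo (Q : PMF (α × β)) (n : ℕ) (d : ℤ) (u v : Bool) (ω : ℤ → α × β)
    (h : blockLaw Q n d (block n d ω) / partialMass (blockLaw Q n d) u v (block n d ω) ≠ 0) :
    ∑ t ∈ window n d, letterInfo Q n d u v t (ω t) =
      -Real.logb 2 (blockLaw Q n d (block n d ω) /
        partialMass (blockLaw Q n d) u v (block n d ω)) := by
  rw [blockLaw_block, partialMass_blockLaw, ← Finset.prod_div_distrib] at h ⊢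
  rw [Real.logb_prod _ _ (fun t ht => Finset.prod_ne_zero_iff.1 h t ht), ← Finset.sum_neg_distrib]
  rfl

/-- The mean information per letter, measured by a distribution `Q` that dominates the true
`P` up to a factor `c`, exceeds the entropy by at most `log c`. -/
lemma sum_mass_mul_letterInfo_le {Q : PMF (α × β)} {c : ℝ} (hQ : ∀ z, 0 < mass Q z) (hc : 0 < c)
    (hPQ : ∀ z, mass P z ≤ c * mass Q z) (n : ℕ) (d : ℤ) (u v : Bool) (t : ℤ) :
    ∑ z, mass P z * letterInfo Q n d u v t z ≤
      partialEntropy P (decide (t ∈ windowX n)) (decide (t ∈ windowY n d)) -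
      partialEntropy P (u && decide (t ∈ windowX n)) (v && decide (t ∈ windowY n d)) +
      Real.logb 2 c := by
  unfold letterInfo
  generalize decide (t ∈ windowX n) = a
  generalize decide (t ∈ windowY n d) = b
  have hpos : ∀ a b z, 0 < partialMass (mass Q) a b z := fun a b z =>
    partialMass_pos_of_mass_pos Q (hQ z) a b
  have hG := sum_mul_logb_nonpos (mass_nonneg P) (sum_mass P)
    (fun z h => div_pos (hpos (u && a) (v && b) z) (partialMass_pos_of_mass_pos P h _ _))
    (sum_mass_mul_partialMass_div_le P Q (u && a) (v && b))
  have key : ∀ z, mass P z * -Real.logb 2 (partialMass (mass Q) a b z /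
        partialMass (mass Q) (u && a) (v && b) z) ≤
      mass P z * -Real.logb 2 (partialMass (mass P) a b z) -
      mass P z * -Real.logb 2 (partialMass (mass P) (u && a) (v && b) z) +
      mass P z * Real.logb 2 c +
      mass P z * Real.logb 2 (partialMass (mass Q) (u && a) (v && b) z /
        partialMass (mass P) (u && a) (v && b) z) := by
    intro z
    rcases (mass_nonneg P z).eq_or_lt with h0 | h0
    · simp [← h0]
    · have h1 := partialMass_pos_of_mass_pos P h0 a b
      have h2 := partialMass_pos_of_mass_pos P h0 (u && a) (v && b)
      have h3 : Real.logb 2 (partialMass (mass P) a b z) ≤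
          Real.logb 2 (c * partialMass (mass Q) a b z) :=
        Real.logb_le_logb_of_le (by norm_num) h1 (partialMass_mono hPQ a b z)
      rw [Real.logb_mul hc.ne' (hpos _ _ _).ne'] at h3
      rw [Real.logb_div (hpos _ _ _).ne' (hpos _ _ _).ne', Real.logb_div (hpos _ _ _).ne' h2.ne',
        ← mul_sub, ← mul_add, ← mul_add]
      exact mul_le_mul_of_nonneg_left (by linarith) h0.le
  have hsum := Finset.sum_le_sum fun z (_ : z ∈ Finset.univ) => key z
  simp only [Finset.sum_add_distrib, Finset.sum_sub_distrib, ← Finset.sum_mul, sum_mass] at hsum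
  unfold partialEntropy
  linarith

/-- For `Q = P` the mean information per letter is the entropy. -/
lemma sum_mass_mul_letterInfo (n : ℕ) (d : ℤ) (u v : Bool) (t : ℤ) :
    ∑ z, mass P z * letterInfo P n d u v t z =
      partialEntropy P (decide (t ∈ windowX n)) (decide (t ∈ windowY n d)) -
      partialEntropy P (u && decide (t ∈ windowX n)) (v && decide (t ∈ windowY n d)) := by
  rw [partialEntropy, partialEntropy, ← Finset.sum_sub_distrib]
  refine Finset.sum_congr rfl fun z _ => ?_
  rcases (mass_nonneg P z).eq_or_lt with h0 | h0
  · simp [← h0]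
  · rw [letterInfo, Real.logb_div (partialMass_pos_of_mass_pos P h0 _ _).ne'
      (partialMass_pos_of_mass_pos P h0 _ _).ne']
    ring

/-- Only the `n - |d|` times at which both sources are seen, and the `|d|` times of each kind at
which one of them is seen, contribute to a sum over the window. -/
lemma sum_window (n : ℕ) (d : ℤ) (hd : |d| ≤ n) (F : Bool → Bool → ℝ) :
    ∑ t ∈ window n d, F (decide (t ∈ windowX n)) (decide (t ∈ windowY n d)) =
      (n - |(d : ℝ)|) * F true true + |(d : ℝ)| * (F true false + F false true) := by
  have hX : ((windowX n \ windowY n d).card : ℝ) = |(d : ℝ)| := by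
    have h := Finset.card_sdiff_add_card_inter (windowX n) (windowY n d)
    rw [card_windowX] at h
    have h' : ((windowX n \ windowY n d).card : ℝ) + (windowX n ∩ windowY n d).card = n := by
      exact_mod_cast h
    rw [card_window_inter hd] at h'
    linarith
  have hY : ((windowY n d \ windowX n).card : ℝ) = |(d : ℝ)| := by
    have h := Finset.card_sdiff_add_card_inter (windowY n d) (windowX n)
    rw [card_windowY, Finset.inter_comm] at h
    have h' : ((windowY n d \ windowX n).card : ℝ) + (windowX n ∩ windowY n d).card = n := by
      exact_mod_cast h
    rw [card_window_inter hd] at h'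
    linarith
  have hU : window n d = ((windowX n ∩ windowY n d) ∪ (windowX n \ windowY n d)) ∪
      (windowY n d \ windowX n) := by
    ext t; simp only [window, Finset.mem_union, Finset.mem_inter, Finset.mem_sdiff]; tauto
  rw [hU, Finset.sum_union, Finset.sum_union]
  · rw [Finset.sum_congr rfl (g := fun _ => F true true) (fun t ht => by
        rw [Finset.mem_inter] at ht; simp [ht.1, ht.2]),
      Finset.sum_congr (s₁ := windowX n \ windowY n d) rfl (g := fun _ => F true false)
        (fun t ht => by rw [Finset.mem_sdiff] at ht; simp [ht.1, ht.2]),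
      Finset.sum_congr (s₁ := windowY n d \ windowX n) rfl (g := fun _ => F false true)
        (fun t ht => by rw [Finset.mem_sdiff] at ht; simp [ht.1, ht.2])]
    simp only [Finset.sum_const, nsmul_eq_mul, hX, hY, card_window_inter hd]
    ring
  · rw [Finset.disjoint_left]; intro t; simp only [Finset.mem_inter, Finset.mem_sdiff]; tauto
  · rw [Finset.disjoint_left]; intro t
    simp only [Finset.mem_union, Finset.mem_inter, Finset.mem_sdiff]; tauto

/-- The entropy of the pair of blocks given the side information `(u, v)`: a delay `d` costs
`|d| I(X; Y)` bits compared to synchronized encoders, whatever the side information. -/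
lemma sum_window_partialEntropy (n : ℕ) (d : ℤ) (hd : |d| ≤ n) {u v : Bool}
    (huv : (u && v) = false) :
    ∑ t ∈ window n d,
      (partialEntropy P (decide (t ∈ windowX n)) (decide (t ∈ windowY n d)) -
        partialEntropy P (u && decide (t ∈ windowX n)) (v && decide (t ∈ windowY n d))) =
      n * (partialEntropy P true true - partialEntropy P u v) + |(d : ℝ)| * mutualInfo P := by
  rw [sum_window n d hd
    (fun a b => partialEntropy P a b - partialEntropy P (u && a) (v && b)), mutualInfo_eq]
  rcases u with _ | _ <;> rcases v with _ | _ <;>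
    simp_all [partialEntropy_false_false] <;> ring

/-- For a fixed source the information per letter is bounded, also at letters of mass zero, where
the logarithm has a junk value: it is a function on a finite set. -/
lemma exists_abs_letterInfo_le : ∃ L, ∀ n d u v t z, |letterInfo P n d u v t z| ≤ L := by
  let G : Bool × Bool × Bool × Bool × (α × β) → ℝ := fun i => |-Real.logb 2
    (partialMass (mass P) i.1 i.2.1 i.2.2.2.2 /
      partialMass (mass P) i.2.2.1 i.2.2.2.1 i.2.2.2.2)|
  obtain ⟨L, hL⟩ := (Set.finite_range G).bddAbove
  exact ⟨L, fun n d u v t z => hL ⟨(decide (t ∈ windowX n), decide (t ∈ windowY n d),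
    u && decide (t ∈ windowX n), v && decide (t ∈ windowY n d), z), rfl⟩⟩

lemma abs_letterInfo_le_logb {Q : PMF (α × β)} {N : ℝ} (hN : 0 < N) (hQ : ∀ z, 1 / N ≤ mass Q z)
    (n : ℕ) (d : ℤ) (u v : Bool) (t : ℤ) (z : α × β) :
    |letterInfo Q n d u v t z| ≤ Real.logb 2 N := by
  unfold letterInfo
  generalize decide (t ∈ windowX n) = a
  generalize decide (t ∈ windowY n d) = b
  have hz : 0 < mass Q z := (one_div_pos.2 hN).trans_le (hQ z)
  have h1 := partialMass_pos_of_mass_pos Q hz a b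
  have h2 := partialMass_pos_of_mass_pos Q hz (u && a) (v && b)
  have h3 := partialMass_anti (mass_nonneg Q) a b u v z
  have h4 := partialMass_le_one (mass_nonneg Q) (sum_mass Q) (u && a) (v && b) z
  have h5 : 1 / N ≤ partialMass (mass Q) a b z / partialMass (mass Q) (u && a) (v && b) z :=
    ((hQ z).trans (le_partialMass (mass_nonneg Q) a b z)).trans
      (le_div_self h1.le h2 h4)
  have h6 : Real.logb 2 (partialMass (mass Q) a b z /
      partialMass (mass Q) (u && a) (v && b) z) ≤ 0 :=
    Real.logb_nonpos (by norm_num) (div_pos h1 h2).le ((div_le_one h2).2 h3)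
  have h7 := Real.logb_le_logb_of_le (b := 2) (by norm_num) (one_div_pos.2 hN) h5
  rw [one_div, Real.logb_inv] at h7
  rw [abs_neg, abs_of_nonpos h6]
  linarith

end

/-! ### One-shot bounds for Slepian–Wolf codes -/

/-- The number of pairs of codewords once the codewords of the sources selected by `(u, v)`
are fixed. -/
def freeCodewords (M₁ M₂ : ℕ) (u v : Bool) : ℕ := (if u then 1 else M₁) * (if v then 1 else M₂)

section
variable {A B : Type*} [Fintype A] [Fintype B] {M₁ M₂ : ℕ}

/-- Given the side information, the code recovers at most as many pairs as there are
codewords left. -/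
lemma card_correct_le (f₁ : A → Fin M₁) (f₂ : B → Fin M₂) (g : Fin M₁ × Fin M₂ → A × B)
    (u v : Bool) (z : A × B) [DecidablePred fun w : A × B => g (f₁ w.1, f₂ w.2) = w] :
    ((agreeSet u v z).filter fun w => g (f₁ w.1, f₂ w.2) = w).card ≤ freeCodewords M₁ M₂ u v := by
  let S₁ : Finset (Fin M₁) := if u then {f₁ z.1} else Finset.univ
  let S₂ : Finset (Fin M₂) := if v then {f₂ z.2} else Finset.univ
  have hcard : (S₁ ×ˢ S₂).card = freeCodewords M₁ M₂ u v := by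
    rw [Finset.card_product, freeCodewords]
    cases u <;> cases v <;> simp [S₁, S₂]
  rw [← hcard]
  refine Finset.card_le_card_of_injOn (fun w => (f₁ w.1, f₂ w.2)) ?_ ?_
  · intro w hw
    simp only [Finset.coe_filter, Set.mem_ofPred_eq, mem_agreeSet] at hw
    rw [Finset.coe_product, Set.mem_prod]
    constructor
    · cases u
      · simp [S₁]
      · simpa [S₁] using congrArg f₁ (hw.1.1 rfl)
    · cases v
      · simp [S₂]
      · simpa [S₂] using congrArg f₂ (hw.1.2 rfl)
  · intro w hw w' hw' h
    simp only [Finset.coe_filter, Set.mem_ofPred_eq] at hw hw'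
    rw [← hw.2, ← hw'.2]
    exact congrArg g h

/-- One-shot converse: pairs whose conditional probability given the side information is at
most `1 / K` are recovered with probability at most (number of codewords) `/ K`. -/
lemma sum_correct_le (f₁ : A → Fin M₁) (f₂ : B → Fin M₂) (g : Fin M₁ × Fin M₂ → A × B)
    {p : A × B → ℝ} (hp : ∀ z, 0 ≤ p z) (h1 : ∑ z, p z = 1) (u v : Bool) {K : ℝ} (hK : 0 < K)
    (s : Finset (A × B)) (hs : ∀ z ∈ s, g (f₁ z.1, f₂ z.2) = z ∧ K * p z ≤ partialMass p u v z) :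
    ∑ z ∈ s, p z ≤ freeCodewords M₁ M₂ u v / K := by
  classical
  rw [le_div_iff₀ hK, mul_comm, Finset.mul_sum]
  calc ∑ z ∈ s, K * p z ≤ ∑ z ∈ s, partialMass p u v z :=
        Finset.sum_le_sum fun z hz => (hs z hz).2
    _ ≤ ∑ z with g (f₁ z.1, f₂ z.2) = z, partialMass p u v z :=
        Finset.sum_le_sum_of_subset_of_nonneg
          (fun z hz => Finset.mem_filter.2 ⟨Finset.mem_univ _, (hs z hz).1⟩)
          fun z _ _ => partialMass_nonneg hp u v z
    _ = ∑ z with g (f₁ z.1, f₂ z.2) = z, ∑ w, if w ∈ agreeSet u v z then p w else 0 := by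
        refine Finset.sum_congr rfl fun z _ => ?_
        rw [← Finset.sum_filter, Finset.filter_mem_eq_inter, Finset.univ_inter, partialMass]
    _ = ∑ w, ((agreeSet u v w).filter fun z => g (f₁ z.1, f₂ z.2) = z).card * p w := by
        rw [Finset.sum_comm]
        refine Finset.sum_congr rfl fun w _ => ?_
        rw [← nsmul_eq_mul, ← Finset.sum_const, ← Finset.sum_filter]
        refine Finset.sum_congr ?_ fun _ _ => rfl
        ext z
        simp only [Finset.mem_filter, Finset.mem_univ, true_and]
        rw [mem_agreeSet_comm, and_comm]
    _ ≤ ∑ w, (freeCodewords M₁ M₂ u v : ℝ) * p w :=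
        Finset.sum_le_sum fun w _ => mul_le_mul_of_nonneg_right
          (by exact_mod_cast card_correct_le f₁ f₂ g u v w) (hp w)
    _ = freeCodewords M₁ M₂ u v := by rw [← Finset.mul_sum, h1, mul_one]

/-- A uniformly random map identifies two distinct points with probability `1 / M`. -/
lemma sum_collision {A : Type*} [Fintype A] [DecidableEq A] {M : ℕ} {x x' : A} (h : x ≠ x') :
    M * ∑ f : A → Fin M, (if f x = f x' then (1 : ℝ) else 0) = Fintype.card (A → Fin M) := by
  rcases Nat.eq_zero_or_pos M with rfl | hM
  · have : IsEmpty (A → Fin 0) := ⟨fun f => (f x).elim0⟩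
    simp
  have h1 : ∑ f : A → Fin M, (if f x = f x' then (1 : ℝ) else 0) =
      Fintype.card ({j // j ≠ x} → Fin M) := by
    rw [← (Equiv.funSplitAt x (Fin M)).symm.sum_comp, Fintype.sum_prod_type_right]
    have : ∀ r : {j // j ≠ x} → Fin M, ∑ b : Fin M,
        (if (Equiv.funSplitAt x (Fin M)).symm (b, r) x = (Equiv.funSplitAt x (Fin M)).symm (b, r) x'
          then (1 : ℝ) else 0) = 1 := by
      intro r
      have h2 : ∀ b, ((Equiv.funSplitAt x (Fin M)).symm (b, r) x =
          (Equiv.funSplitAt x (Fin M)).symm (b, r) x') ↔ b = r ⟨x', h.symm⟩ := by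
        intro b
        simp [Equiv.funSplitAt, Equiv.piSplitAt, h.symm]
      simp only [h2]
      simp
    simp only [this]
    simp
  rw [h1]
  have h3 := Fintype.card_congr (Equiv.funSplitAt x (Fin M))
  rw [Fintype.card_prod, Fintype.card_fin] at h3
  rw [h3]; push_cast; ring

open scoped Classical in
/-- Random binning: if the sections of `T` are small compared to the numbers of codewords, then
for any given weight `W` some pair of maps has collisions inside `T` of small total weight, because
the average over all pairs of maps does. -/
lemma exists_binning (hM₁ : 0 < M₁) (hM₂ : 0 < M₂) (T : Finset (A × B)) {κ : ℝ}
    (hκ : 0 ≤ κ)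
    (hT : ∀ u v, (u && v) = false → ∀ z,
      ((agreeSet u v z ∩ T).card : ℝ) ≤ κ * freeCodewords M₁ M₂ u v)
    {W : A × B → ℝ} (hW : ∀ z, 0 ≤ W z) :
    ∃ (f₁ : A → Fin M₁) (f₂ : B → Fin M₂),
      ∑ z ∈ T, W z * (if ∃ w ∈ T, w ≠ z ∧ f₁ w.1 = f₁ z.1 ∧ f₂ w.2 = f₂ z.2 then 1 else 0) ≤
        3 * κ * ∑ z, W z := by
  have hM₁' : (0 : ℝ) < M₁ := by exact_mod_cast hM₁
  have hM₂' : (0 : ℝ) < M₂ := by exact_mod_cast hM₂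
  have : Nonempty (Fin M₁) := ⟨⟨0, hM₁⟩⟩
  have : Nonempty (Fin M₂) := ⟨⟨0, hM₂⟩⟩
  set N : ℝ := (Fintype.card ((A → Fin M₁) × (B → Fin M₂)) : ℝ) with hN
  have hNc : N = Fintype.card (A → Fin M₁) * Fintype.card (B → Fin M₂) := by
    rw [hN, Fintype.card_prod, Nat.cast_mul]
  have hN0 : 0 ≤ N := Nat.cast_nonneg _
  -- the number of pairs of maps under which `w` and `z` collide
  have hpair : ∀ z w : A × B, w ≠ z →
      ∑ f : (A → Fin M₁) × (B → Fin M₂),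
        (if f.1 w.1 = f.1 z.1 ∧ f.2 w.2 = f.2 z.2 then (1 : ℝ) else 0) ≤
      N * ((if w ∈ agreeSet true false z then (freeCodewords M₁ M₂ true false : ℝ)⁻¹ else 0) +
        (if w ∈ agreeSet false true z then (freeCodewords M₁ M₂ false true : ℝ)⁻¹ else 0) +
        (if w ∈ agreeSet false false z then (freeCodewords M₁ M₂ false false : ℝ)⁻¹ else 0)) := by
    intro z w hwz
    have hfac : ∑ f : (A → Fin M₁) × (B → Fin M₂),
        (if f.1 w.1 = f.1 z.1 ∧ f.2 w.2 = f.2 z.2 then (1 : ℝ) else 0) =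
        (∑ f : A → Fin M₁, if f w.1 = f z.1 then (1 : ℝ) else 0) *
        ∑ f : B → Fin M₂, if f w.2 = f z.2 then (1 : ℝ) else 0 := by
      rw [Fintype.sum_prod_type, Finset.sum_mul]
      refine Finset.sum_congr rfl fun f _ => ?_
      rw [Finset.mul_sum]
      refine Finset.sum_congr rfl fun g _ => ?_
      by_cases h1 : f w.1 = f z.1 <;> by_cases h2 : g w.2 = g z.2 <;> simp [h1, h2]
    have hc₁ : w.1 ≠ z.1 → (∑ f : A → Fin M₁, if f w.1 = f z.1 then (1 : ℝ) else 0) =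
        Fintype.card (A → Fin M₁) * (M₁ : ℝ)⁻¹ := fun h => by
      rw [← sum_collision h]; field_simp
    have hc₂ : w.2 ≠ z.2 → (∑ f : B → Fin M₂, if f w.2 = f z.2 then (1 : ℝ) else 0) =
        Fintype.card (B → Fin M₂) * (M₂ : ℝ)⁻¹ := fun h => by
      rw [← sum_collision h]; field_simp
    rw [hfac, hNc]
    simp only [mem_agreeSet, freeCodewords, Bool.false_eq_true, false_implies, true_and, and_true,
      if_true, if_false, one_mul, mul_one, forall_const, Nat.cast_mul, mul_inv]
    by_cases h1 : w.1 = z.1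
    · have h2 : w.2 ≠ z.2 := fun h2 => hwz (Prod.ext h1 h2)
      rw [hc₂ h2]
      simp only [h1, h2, if_true, if_false, Finset.sum_const, Finset.card_univ, nsmul_eq_mul,
        mul_one]
      rw [mul_assoc]
      refine mul_le_mul_of_nonneg_left ?_ (Nat.cast_nonneg _)
      refine mul_le_mul_of_nonneg_left ?_ (Nat.cast_nonneg _)
      have : 0 ≤ (M₁ : ℝ)⁻¹ * (M₂ : ℝ)⁻¹ := by positivity
      linarith
    · rw [hc₁ h1]
      by_cases h2 : w.2 = z.2
      · simp only [h1, h2, if_true, if_false, Finset.sum_const, Finset.card_univ, nsmul_eq_mul,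
          mul_one]
        have : 0 ≤ (M₁ : ℝ)⁻¹ * (M₂ : ℝ)⁻¹ := by positivity
        calc _ = (Fintype.card (A → Fin M₁) * Fintype.card (B → Fin M₂) : ℝ) * (M₁ : ℝ)⁻¹ := by
              ring
          _ ≤ _ := mul_le_mul_of_nonneg_left (by linarith) (by positivity)
      · rw [hc₂ h2]
        simp only [h1, h2, if_false]
        apply le_of_eq
        ring
  have hsec : ∀ u v, (u && v) = false → ∀ z,
      ∑ w ∈ T, (if w ∈ agreeSet u v z then (freeCodewords M₁ M₂ u v : ℝ)⁻¹ else 0) ≤ κ := by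
    intro u v huv z
    have hpos : (0 : ℝ) < freeCodewords M₁ M₂ u v := by
      have : 0 < freeCodewords M₁ M₂ u v := by
        unfold freeCodewords; cases u <;> cases v <;> simp <;> omega
      exact_mod_cast this
    rw [← Finset.sum_filter, Finset.filter_mem_eq_inter, Finset.inter_comm, Finset.sum_const,
      nsmul_eq_mul, ← div_eq_mul_inv, div_le_iff₀ hpos]
    exact hT u v huv z
  have hcoll : ∀ z, ∑ f : (A → Fin M₁) × (B → Fin M₂),
      (if ∃ w ∈ T, w ≠ z ∧ f.1 w.1 = f.1 z.1 ∧ f.2 w.2 = f.2 z.2 then (1 : ℝ) else 0) ≤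
      N * (3 * κ) := by
    intro z
    calc ∑ f : (A → Fin M₁) × (B → Fin M₂),
        (if ∃ w ∈ T, w ≠ z ∧ f.1 w.1 = f.1 z.1 ∧ f.2 w.2 = f.2 z.2 then (1 : ℝ) else 0)
        ≤ ∑ f : (A → Fin M₁) × (B → Fin M₂), ∑ w ∈ T with w ≠ z,
          (if f.1 w.1 = f.1 z.1 ∧ f.2 w.2 = f.2 z.2 then (1 : ℝ) else 0) := by
          refine Finset.sum_le_sum fun f _ => ?_
          have hnn : ∀ w ∈ T.filter (· ≠ z),
              0 ≤ (if f.1 w.1 = f.1 z.1 ∧ f.2 w.2 = f.2 z.2 then (1 : ℝ) else 0) :=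
            fun w _ => by split_ifs <;> norm_num
          split_ifs with h
          · obtain ⟨w, hwT, hwz, hw⟩ := h
            refine le_trans ?_ (Finset.single_le_sum hnn (Finset.mem_filter.2 ⟨hwT, hwz⟩))
            rw [if_pos hw]
          · exact Finset.sum_nonneg hnn
      _ = ∑ w ∈ T with w ≠ z, ∑ f : (A → Fin M₁) × (B → Fin M₂),
          (if f.1 w.1 = f.1 z.1 ∧ f.2 w.2 = f.2 z.2 then (1 : ℝ) else 0) := Finset.sum_comm
      _ ≤ ∑ w ∈ T with w ≠ z, N *
          ((if w ∈ agreeSet true false z then (freeCodewords M₁ M₂ true false : ℝ)⁻¹ else 0) +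
          (if w ∈ agreeSet false true z then (freeCodewords M₁ M₂ false true : ℝ)⁻¹ else 0) +
          (if w ∈ agreeSet false false z then (freeCodewords M₁ M₂ false false : ℝ)⁻¹ else 0)) :=
          Finset.sum_le_sum fun w hw => hpair z w (Finset.mem_filter.1 hw).2
      _ ≤ ∑ w ∈ T, N *
          ((if w ∈ agreeSet true false z then (freeCodewords M₁ M₂ true false : ℝ)⁻¹ else 0) +
          (if w ∈ agreeSet false true z then (freeCodewords M₁ M₂ false true : ℝ)⁻¹ else 0) +
          (if w ∈ agreeSet false false z then (freeCodewords M₁ M₂ false false : ℝ)⁻¹ else 0)) :=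
          Finset.sum_le_sum_of_subset_of_nonneg (Finset.filter_subset _ _)
            fun w _ _ => mul_nonneg hN0 (by positivity)
      _ ≤ N * (3 * κ) := by
          rw [← Finset.mul_sum, Finset.sum_add_distrib, Finset.sum_add_distrib]
          refine mul_le_mul_of_nonneg_left ?_ hN0
          have h1 := hsec true false rfl z
          have h2 := hsec false true rfl z
          have h3 := hsec false false rfl z
          linarith
  have havg : ∃ f : (A → Fin M₁) × (B → Fin M₂), ∑ z ∈ T, W z *
      (if ∃ w ∈ T, w ≠ z ∧ f.1 w.1 = f.1 z.1 ∧ f.2 w.2 = f.2 z.2 then (1 : ℝ) else 0) ≤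
      ∑ z ∈ T, W z * (3 * κ) := by
    by_contra! hlt
    have h1 := Finset.sum_lt_sum_of_nonempty
      (Finset.univ_nonempty (α := (A → Fin M₁) × (B → Fin M₂))) fun f _ => hlt f
    rw [Finset.sum_const, Finset.card_univ, nsmul_eq_mul, Finset.sum_comm, Finset.mul_sum] at h1
    refine absurd h1 (not_lt.2 (Finset.sum_le_sum fun z _ => ?_))
    rw [← Finset.mul_sum]
    calc _ ≤ W z * (N * (3 * κ)) := mul_le_mul_of_nonneg_left (hcoll z) (hW z)
      _ = _ := by rw [hN]; ring
  obtain ⟨f, hf⟩ := havg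
  refine ⟨f.1, f.2, hf.trans ?_⟩
  rw [← Finset.sum_mul, mul_comm]
  exact mul_le_mul_of_nonneg_left (Finset.sum_le_univ_sum_of_nonneg hW) (by positivity)

open scoped Classical in
/-- One-shot achievability: the decoder looks for the unique member of `T` in the bins. -/
lemma exists_code (hM₁ : 0 < M₁) (hM₂ : 0 < M₂) [Nonempty (A × B)] (T : Finset (A × B)) {κ : ℝ}
    (hκ : 0 ≤ κ)
    (hT : ∀ u v, (u && v) = false → ∀ z,
      ((agreeSet u v z ∩ T).card : ℝ) ≤ κ * freeCodewords M₁ M₂ u v)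
    {W : A × B → ℝ} (hW : ∀ z, 0 ≤ W z) :
    ∃ (f₁ : A → Fin M₁) (f₂ : B → Fin M₂) (g : Fin M₁ × Fin M₂ → A × B),
      ∑ z ∈ T with g (f₁ z.1, f₂ z.2) ≠ z, W z ≤ 3 * κ * ∑ z, W z := by
  obtain ⟨f₁, f₂, hf⟩ := exists_binning hM₁ hM₂ T hκ hT hW
  let g : Fin M₁ × Fin M₂ → A × B := fun m =>
    if h : ∃ w ∈ T, (f₁ w.1, f₂ w.2) = m then h.choose else Classical.arbitrary _
  refine ⟨f₁, f₂, g, le_trans ?_ hf⟩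
  rw [Finset.sum_filter]
  refine Finset.sum_le_sum fun z hz => ?_
  by_cases hg : g (f₁ z.1, f₂ z.2) = z
  · rw [if_neg (not_not.2 hg)]
    exact mul_nonneg (hW z) (by split_ifs <;> norm_num)
  · have h : ∃ w ∈ T, (f₁ w.1, f₂ w.2) = (f₁ z.1, f₂ z.2) := ⟨z, hz, rfl⟩
    have hgz : g (f₁ z.1, f₂ z.2) = h.choose := dif_pos h
    rw [if_pos hg, if_pos, mul_one]
    obtain ⟨h1, h2⟩ := h.choose_spec
    rw [← hgz] at h1 h2
    exact ⟨_, h1, hg, (Prod.ext_iff.1 h2).1, (Prod.ext_iff.1 h2).2⟩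

/-- If every pair in `T` has conditional probability at least `1 / K` under one of `|J|`
distributions, then the sections of `T` have at most `|J| K` elements. -/
lemma card_agreeSet_inter_le [DecidableEq (A × B)] {J : Type*} [Fintype J] (p : J → A × B → ℝ)
    (hp : ∀ j z, 0 ≤ p j z) (T : Finset (A × B)) (u v : Bool) {K : ℝ}
    (hK : 0 ≤ K) (hT : ∀ z ∈ T, ∃ j, 0 < p j z ∧ partialMass (p j) u v z ≤ K * p j z) (z : A × B) :
    ((agreeSet u v z ∩ T).card : ℝ) ≤ Fintype.card J * K := by
  classical
  have hsub : agreeSet u v z ∩ T ⊆ Finset.univ.biUnion fun j =>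
      (agreeSet u v z).filter fun w => 0 < p j w ∧ partialMass (p j) u v w ≤ K * p j w := by
    intro w hw
    rw [Finset.mem_inter] at hw
    obtain ⟨j, hj⟩ := hT w hw.2
    exact Finset.mem_biUnion.2 ⟨j, Finset.mem_univ _, Finset.mem_filter.2 ⟨hw.1, hj⟩⟩
  have hone : ∀ j, (((agreeSet u v z).filter fun w => 0 < p j w ∧
      partialMass (p j) u v w ≤ K * p j w).card : ℝ) ≤ K := by
    intro j
    set s := (agreeSet u v z).filter fun w => 0 < p j w ∧ partialMass (p j) u v w ≤ K * p j w
    rcases s.eq_empty_or_nonempty with h | ⟨w, hw⟩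
    · rw [h]; simpa using hK
    have hz : 0 < partialMass (p j) u v z := by
      have := Finset.mem_filter.1 hw
      exact this.2.1.trans_le (Finset.single_le_sum (fun w _ => hp j w) this.1)
    have : s.card * partialMass (p j) u v z ≤ K * partialMass (p j) u v z := by
      calc s.card * partialMass (p j) u v z = ∑ w ∈ s, partialMass (p j) u v w := by
            rw [← nsmul_eq_mul, ← Finset.sum_const]
            refine Finset.sum_congr rfl fun w hw => ?_
            rw [partialMass, partialMass, agreeSet_eq_of_mem (Finset.mem_filter.1 hw).1]
        _ ≤ ∑ w ∈ s, K * p j w := Finset.sum_le_sum fun w hw => (Finset.mem_filter.1 hw).2.2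
        _ ≤ K * partialMass (p j) u v z := by
            rw [← Finset.mul_sum]
            exact mul_le_mul_of_nonneg_left (Finset.sum_le_sum_of_subset_of_nonneg
              (Finset.filter_subset _ _) fun w _ _ => hp j w) hK
    exact le_of_mul_le_mul_right this hz
  calc ((agreeSet u v z ∩ T).card : ℝ)
      ≤ ∑ j, (((agreeSet u v z).filter fun w => 0 < p j w ∧
          partialMass (p j) u v w ≤ K * p j w).card : ℝ) := by
        exact_mod_cast (Finset.card_le_card hsub).trans Finset.card_biUnion_le
    _ ≤ Fintype.card J * K := by
        refine (Finset.sum_le_sum fun j _ => hone j).trans ?_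
        rw [Finset.sum_const, Finset.card_univ, nsmul_eq_mul]

open scoped Classical in
/-- One-shot achievability for finitely many distributions `p j` at once: one code serves all
of them on a set `T` that misses only pairs of low conditional probability. -/
lemma exists_code_of_laws (hM₁ : 0 < M₁) (hM₂ : 0 < M₂) [Nonempty (A × B)] {J : Type*} [Fintype J]
    (p : J → A × B → ℝ) (hp : ∀ j z, 0 ≤ p j z) (h1 : ∀ j, ∑ z, p j z = 1) {κ : ℝ} (hκ : 0 ≤ κ)
    (K : Bool → Bool → ℝ) (hK : ∀ u v, 0 < K u v) (hKM : ∀ u v, (u && v) = false →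
      Fintype.card J * K u v ≤ κ * freeCodewords M₁ M₂ u v) :
    ∃ (f₁ : A → Fin M₁) (f₂ : B → Fin M₂) (g : Fin M₁ × Fin M₂ → A × B) (T : Finset (A × B)),
      (∀ j z, 0 < p j z → z ∉ T → ∃ u v, (u && v) = false ∧
        K u v * p j z < partialMass (p j) u v z) ∧
      ∀ j, ∑ z ∈ T with g (f₁ z.1, f₂ z.2) ≠ z, p j z ≤ 3 * κ * Fintype.card J := by
  let T : Finset (A × B) := Finset.univ.filter fun z =>
    ∃ j, 0 < p j z ∧ ∀ u v, (u && v) = false → partialMass (p j) u v z ≤ K u v * p j z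
  have hT : ∀ u v, (u && v) = false → ∀ z,
      ((agreeSet u v z ∩ T).card : ℝ) ≤ κ * freeCodewords M₁ M₂ u v := by
    intro u v huv z
    refine (card_agreeSet_inter_le p hp T u v (hK u v).le
      (fun z hz => ?_) z).trans (hKM u v huv)
    obtain ⟨j, hj, h⟩ := (Finset.mem_filter.1 hz).2
    exact ⟨j, hj, h u v huv⟩
  obtain ⟨f₁, f₂, g, hg⟩ := exists_code hM₁ hM₂ T hκ hT (W := fun z => ∑ j, p j z)
    (fun z => Finset.sum_nonneg fun j _ => hp j z)
  have hW : ∑ z, ∑ j, p j z = Fintype.card J := by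
    rw [Finset.sum_comm]
    simp [h1]
  rw [hW] at hg
  refine ⟨f₁, f₂, g, T, fun j z hj hz => ?_, fun j => le_trans ?_ hg⟩
  · by_contra! h
    exact hz (Finset.mem_filter.2 ⟨Finset.mem_univ _, j, hj, h⟩)
  · exact Finset.sum_le_sum fun z _ =>
      Finset.single_le_sum (f := fun j => p j z) (fun j _ => hp j z) (Finset.mem_univ j)

end

/-! ### A finite grid of source distributions -/

section
variable {Z : Type*} [Fintype Z] [Nonempty Z]

/-- The distribution proportional to `m + 1`; the summand `1` keeps all masses positive. -/
def gridPMF (m : Z → ℕ) : PMF Z :=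
  PMF.normalize (fun z => ((m z + 1 : ℕ) : ℝ≥0∞))
    (by
      obtain ⟨z⟩ := ‹Nonempty Z›
      rw [tsum_fintype]
      refine fun h => ?_
      have := (Finset.sum_eq_zero_iff.1 h) z (Finset.mem_univ z)
      simp at this)
    (by rw [tsum_fintype]; exact ENNReal.sum_ne_top.2 fun z _ => ENNReal.natCast_ne_top _)

lemma mass_gridPMF (m : Z → ℕ) (z : Z) :
    mass (gridPMF m) z = (m z + 1) / ∑ w, ((m w : ℝ) + 1) := by
  rw [mass, gridPMF, PMF.normalize_apply, ENNReal.toReal_mul, ENNReal.toReal_inv, tsum_fintype,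
    ENNReal.toReal_sum (fun z _ => ENNReal.natCast_ne_top _), div_eq_mul_inv]
  simp only [ENNReal.toReal_natCast]
  push_cast
  rfl

lemma mass_gridPMF_pos (m : Z → ℕ) (z : Z) : 0 < mass (gridPMF m) z := by
  rw [mass_gridPMF]
  exact div_pos (by positivity) (Finset.sum_pos (fun w _ => by positivity) Finset.univ_nonempty)

/-- Every distribution is dominated, up to a factor close to one, by a member of the grid,
namely the one whose numerators are its rounded masses. -/
lemma exists_gridPMF (P : PMF Z) {n : ℕ} (hn : 0 < n) :
    ∃ m : Z → Fin (n + 1), ∀ z,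
      mass P z ≤ (1 + Fintype.card Z / n) * mass (gridPMF fun z => (m z : ℕ)) z ∧
      1 / ((n : ℝ) + Fintype.card Z) ≤ mass (gridPMF fun z => (m z : ℕ)) z := by
  have hn' : (0 : ℝ) < n := by exact_mod_cast hn
  have hfl : ∀ z, (⌊n * mass P z⌋₊ : ℝ) ≤ n * mass P z := fun z =>
    Nat.floor_le (mul_nonneg hn'.le (mass_nonneg P z))
  refine ⟨fun z => ⟨⌊n * mass P z⌋₊, ?_⟩, fun z => ?_⟩
  · rw [Nat.lt_succ_iff]
    have h := (hfl z).trans (mul_le_of_le_one_right hn'.le (mass_le_one P z))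
    exact_mod_cast h
  · rw [mass_gridPMF]
    set s : ℝ := ∑ w, ((⌊n * mass P w⌋₊ : ℝ) + 1) with hs
    have hs0 : 0 < s := Finset.sum_pos (fun w _ => by positivity) Finset.univ_nonempty
    have hs1 : s ≤ n + Fintype.card Z := by
      calc s ≤ ∑ w, (n * mass P w + 1) := Finset.sum_le_sum fun w _ => by linarith [hfl w]
        _ = n + Fintype.card Z := by
            rw [Finset.sum_add_distrib, ← Finset.mul_sum, sum_mass]; simp
    constructor
    · have h1 := Nat.lt_floor_add_one (n * mass P z)
      calc mass P z ≤ ((⌊n * mass P z⌋₊ : ℝ) + 1) / n := by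
            rw [le_div_iff₀ hn']; linarith
        _ = (s / n) * (((⌊n * mass P z⌋₊ : ℝ) + 1) / s) := by field_simp
        _ ≤ _ := by
            refine mul_le_mul_of_nonneg_right ?_ (by positivity)
            rw [div_le_iff₀ hn', add_mul, div_mul_cancel₀ _ hn'.ne', one_mul]
            exact hs1
    · exact div_le_div₀ (by positivity) (by linarith [Nat.cast_nonneg (α := ℝ) ⌊n * mass P z⌋₊])
        hs0 hs1

end

/-! ### Universal codes of a fixed blocklength -/

section
variable {α β : Type*}

/-- Index set of the pairs of a grid distribution and a delay between `-n` and `n`. -/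
abbrev GridIndex (α β : Type*) (n : ℕ) : Type _ := (α × β → Fin (n + 1)) × Fin (2 * n + 1)

lemma errorProb_eq {n : ℕ} (C : Code α β n) (P : PMF (α × β)) (d : ℤ) :
    C.errorProb P d = ENNReal.ofReal (sourceProb P
      {ω | C.dec (C.enc₁ (block n d ω).1, C.enc₂ (block n d ω).2) ≠ block n d ω}) := by
  rw [sourceProb, ENNReal.ofReal_toReal (measure_ne_top _ _)]
  rfl

variable [Fintype α] [Fintype β]

lemma card_gridIndex [DecidableEq (α × β)] (n : ℕ) :
    Fintype.card (GridIndex α β n) = (n + 1) ^ Fintype.card (α × β) * (2 * n + 1) := by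
  simp [GridIndex]

/-- The block law belonging to a grid distribution and a delay. -/
def gridLaw [Nonempty (α × β)] {n : ℕ} (j : GridIndex α β n) :
    (Fin n → α) × (Fin n → β) → ℝ :=
  blockLaw (gridPMF fun z => (j.1 z : ℕ)) n ((j.2 : ℤ) - n)

lemma blockLaw_block_pos {Q : PMF (α × β)} (hQ : ∀ z, 0 < mass Q z) (n : ℕ) (d : ℤ)
    (ω : ℤ → α × β) : 0 < blockLaw Q n d (block n d ω) := by
  rw [blockLaw_block]
  exact Finset.prod_pos fun t _ => partialMass_pos_of_mass_pos Q (hQ _) _ _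

/-- A single code that works for all sources and all delays: its error probability is small
except for blocks whose information density, with respect to a grid distribution close to
the true one, exceeds the thresholds `log K`. -/
lemma exists_universal_code [DecidableEq (α × β)] [Nonempty (α × β)] {n M₁ M₂ : ℕ} (hn : 0 < n)
    (hM₁ : 0 < M₁) (hM₂ : 0 < M₂) {κ : ℝ} (hκ : 0 ≤ κ) (K : Bool → Bool → ℝ)
    (hK : ∀ u v, 0 < K u v) (hKM : ∀ u v, (u && v) = false →
      Fintype.card (GridIndex α β n) * K u v ≤ κ * freeCodewords M₁ M₂ u v) :
    ∃ C : Code α β n, C.M₁ = M₁ ∧ C.M₂ = M₂ ∧ ∀ (P : PMF (α × β)) (d : ℤ), |d| ≤ n →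
      ∃ Q : PMF (α × β), (∀ z, mass P z ≤ (1 + Fintype.card (α × β) / n) * mass Q z) ∧
        (∀ z, 1 / ((n : ℝ) + Fintype.card (α × β)) ≤ mass Q z) ∧
        C.errorProb P d ≤ ENNReal.ofReal
          ((1 + Fintype.card (α × β) / n) ^ (2 * n) *
            (3 * κ * Fintype.card (GridIndex α β n)) +
          (sourceProb P {ω | Real.logb 2 (K true false) <
              ∑ t ∈ window n d, letterInfo Q n d true false t (ω t)} +
          sourceProb P {ω | Real.logb 2 (K false true) <
              ∑ t ∈ window n d, letterInfo Q n d false true t (ω t)} +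
          sourceProb P {ω | Real.logb 2 (K false false) <
              ∑ t ∈ window n d, letterInfo Q n d false false t (ω t)})) := by
  classical
  have : Nonempty ((Fin n → α) × (Fin n → β)) := by
    obtain ⟨x, y⟩ := ‹Nonempty (α × β)›
    exact ⟨⟨fun _ => x, fun _ => y⟩⟩
  obtain ⟨f₁, f₂, g, T, hT, hg⟩ := exists_code_of_laws hM₁ hM₂
    (fun j : GridIndex α β n => gridLaw j) (fun j z => blockLaw_nonneg _ _ _ _)
    (fun j => sum_blockLaw _ _ _) hκ K hK hKM
  refine ⟨⟨M₁, M₂, hM₁, hM₂, f₁, f₂, g⟩, rfl, rfl, fun P d hd => ?_⟩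
  obtain ⟨m, hm⟩ := exists_gridPMF P hn
  set Q := gridPMF fun z => (m z : ℕ) with hQ
  set c : ℝ := 1 + Fintype.card (α × β) / n with hc
  have hc1 : 1 ≤ c := by rw [hc]; linarith [show (0 : ℝ) ≤ Fintype.card (α × β) / n by positivity]
  refine ⟨Q, fun z => (hm z).1, fun z => (hm z).2, ?_⟩
  rw [errorProb_eq]
  refine ENNReal.ofReal_le_ofReal ?_
  obtain ⟨j, hj⟩ : ∃ j : GridIndex α β n, gridLaw j = blockLaw Q n d := by
    have hd' := abs_le.1 hd
    refine ⟨(m, ⟨(d + n).toNat, by omega⟩), ?_⟩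
    rw [gridLaw, hQ]
    congr 1
    simp only
    omega
  set s := T.filter fun z => g (f₁ z.1, f₂ z.2) ≠ z with hs
  have hsub : {ω | g (f₁ (block n d ω).1, f₂ (block n d ω).2) ≠ block n d ω} ⊆
      {ω | block n d ω ∈ s} ∪ ({ω | Real.logb 2 (K true false) <
        ∑ t ∈ window n d, letterInfo Q n d true false t (ω t)} ∪
      {ω | Real.logb 2 (K false true) <
        ∑ t ∈ window n d, letterInfo Q n d false true t (ω t)} ∪
      {ω | Real.logb 2 (K false false) <
        ∑ t ∈ window n d, letterInfo Q n d false false t (ω t)}) := by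
    intro ω hω
    by_cases hωT : block n d ω ∈ T
    · exact Or.inl (Finset.mem_filter.2 ⟨hωT, hω⟩)
    right
    have hp : 0 < blockLaw Q n d (block n d ω) := blockLaw_block_pos (mass_gridPMF_pos _) n d ω
    have hex := hT j (block n d ω) (by simpa only [hj] using hp) hωT
    simp only [hj] at hex
    obtain ⟨u, v, huv, h⟩ := hex
    have hpm := hp.trans_le (le_partialMass (blockLaw_nonneg Q n d) u v (block n d ω))
    have hlt : Real.logb 2 (K u v) < ∑ t ∈ window n d, letterInfo Q n d u v t (ω t) := by
      rw [sum_letterInfo Q n d u v ω (div_pos hp hpm).ne', ← Real.logb_inv, inv_div]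
      exact Real.logb_lt_logb (by norm_num) (hK u v) ((lt_div_iff₀ hp).2 h)
    rcases u with _ | _ <;> rcases v with _ | _
    · exact Or.inr hlt
    · exact Or.inl (Or.inr hlt)
    · exact Or.inl (Or.inl hlt)
    · simp at huv
  refine (sourceProb_mono P hsub).trans ((sourceProb_union_le P _ _).trans (add_le_add ?_
    ((sourceProb_union_le P _ _).trans (add_le_add_left (sourceProb_union_le P _ _) _))))
  rw [sourceProb_block]
  calc ∑ z ∈ s, blockLaw P n d z ≤ ∑ z ∈ s, c ^ (2 * n) * blockLaw Q n d z := by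
        refine Finset.sum_le_sum fun z _ => ?_
        refine (blockLaw_le P n d (zero_le_one.trans hc1) (fun z => (hm z).1) z).trans ?_
        exact mul_le_mul_of_nonneg_right (pow_le_pow_right₀ hc1 (card_window_le n d))
          (blockLaw_nonneg _ _ _ _)
    _ ≤ c ^ (2 * n) * (3 * κ * Fintype.card (GridIndex α β n)) := by
        rw [← Finset.mul_sum, ← hj]
        exact mul_le_mul_of_nonneg_left (le_trans (le_of_eq (by congr!)) (hg j)) (by positivity)

/-- The information density of the blocks rarely exceeds the conditional entropy. -/
lemma sourceProb_letterInfo_le (P : PMF (α × β)) {Q : PMF (α × β)} {c N : ℝ} (hc : 1 ≤ c)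
    (hN : 0 < N) (hPQ : ∀ z, mass P z ≤ c * mass Q z) (hQ : ∀ z, 1 / N ≤ mass Q z) {n : ℕ} {d : ℤ}
    (hd : |d| ≤ n) {u v : Bool} (huv : (u && v) = false) {a x : ℝ} (ha : 0 < a)
    (hx : n * (partialEntropy P true true - partialEntropy P u v) + |(d : ℝ)| * mutualInfo P +
      2 * n * Real.logb 2 c + a ≤ x) :
    sourceProb P {ω | x < ∑ t ∈ window n d, letterInfo Q n d u v t (ω t)} ≤
      2 * n * Real.logb 2 N ^ 2 / a ^ 2 := by
  have hQ0 : ∀ z, 0 < mass Q z := fun z => (one_div_pos.2 hN).trans_le (hQ z)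
  have hcard : ((window n d).card : ℝ) ≤ 2 * n := by exact_mod_cast card_window_le n d
  have hmean : ∑ t ∈ window n d, ∑ z, mass P z * letterInfo Q n d u v t z ≤
      n * (partialEntropy P true true - partialEntropy P u v) + |(d : ℝ)| * mutualInfo P +
        2 * n * Real.logb 2 c := by
    rw [← sum_window_partialEntropy P n d hd huv]
    calc _ ≤ _ := Finset.sum_le_sum fun t _ =>
          sum_mass_mul_letterInfo_le P hQ0 (by linarith) hPQ n d u v t
      _ ≤ _ := by
          rw [Finset.sum_add_distrib, Finset.sum_const, nsmul_eq_mul]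
          exact add_le_add_right
            (mul_le_mul_of_nonneg_right hcard (Real.logb_nonneg (by norm_num) hc)) _
  refine le_trans (sourceProb_mono P ?_) ((sourceProb_chebyshev P (window n d)
    (letterInfo Q n d u v) (abs_letterInfo_le_logb hN hQ n d u v) ha).trans ?_)
  · intro ω (hω : x < _)
    change a ≤ |_ - _|
    refine le_trans ?_ (le_abs_self _)
    linarith
  · gcongr

end

/-! ### Asymptotics: the direct part -/

/-- The joint rate of the sources that are not selected by `(u, v)`. -/
def freeRate (R₁ R₂ : ℝ) (u v : Bool) : ℝ := (if u then 0 else R₁) + (if v then 0 else R₂)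

lemma two_rpow_freeRate_le {M₁ M₂ : ℕ} {x₁ x₂ : ℝ} (h₁ : (2 : ℝ) ^ x₁ ≤ M₁)
    (h₂ : (2 : ℝ) ^ x₂ ≤ M₂) (u v : Bool) :
    (2 : ℝ) ^ freeRate x₁ x₂ u v ≤ freeCodewords M₁ M₂ u v := by
  rw [freeRate, Real.rpow_add (by norm_num), freeCodewords, Nat.cast_mul]
  refine mul_le_mul ?_ ?_ (by positivity) (by positivity)
  · cases u <;> simp [h₁]
  · cases v <;> simp [h₂]

/-- Rounding up the number of codewords costs at most one bit. -/
lemma logb_ceil_le {x : ℝ} (hx : 0 ≤ x) : Real.logb 2 (⌈(2 : ℝ) ^ x⌉₊ : ℝ) ≤ x + 1 := by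
  have h1 : (1 : ℝ) ≤ 2 ^ x := Real.one_le_rpow (by norm_num) hx
  have h2 : (⌈(2 : ℝ) ^ x⌉₊ : ℝ) ≤ 2 ^ (x + 1) := by
    rw [Real.rpow_add (by norm_num), Real.rpow_one]
    linarith [Nat.ceil_lt_add_one (show (0 : ℝ) ≤ 2 ^ x by positivity)]
  have h3 : (0 : ℝ) < ⌈(2 : ℝ) ^ x⌉₊ := by
    have : 0 < ⌈(2 : ℝ) ^ x⌉₊ := Nat.ceil_pos.2 (by linarith)
    exact_mod_cast this
  calc _ ≤ Real.logb 2 (2 ^ (x + 1)) := Real.logb_le_logb_of_le (by norm_num) h3 h2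
    _ = x + 1 := Real.logb_rpow (by norm_num) (by norm_num)

/-- The number of grid points is polynomial, so that an exponentially small fraction of its
square vanishes. -/
lemma tendsto_card_gridIndex_sq_mul (α β : Type*) [Fintype α] [Fintype β] [DecidableEq (α × β)]
    {δ : ℝ} (hδ : 0 < δ) :
    Tendsto (fun n : ℕ => (Fintype.card (GridIndex α β n) : ℝ) ^ 2 * (2 : ℝ) ^ (-(n * δ)))
      atTop (𝓝 0) := by
  set k := Fintype.card (α × β) with hk
  set r : ℝ := (2 : ℝ) ^ (-δ) with hr
  have hr0 : 0 < r := by positivity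
  have hr1 : r < 1 := Real.rpow_lt_one_of_one_lt_of_neg (by norm_num) (by linarith)
  have h := (tendsto_pow_const_mul_const_pow_of_abs_lt_one (2 * k + 2)
    (show |r| < 1 by rwa [abs_of_pos hr0])).const_mul ((4 : ℝ) ^ (2 * k + 2))
  rw [mul_zero] at h
  refine squeeze_zero' (Eventually.of_forall fun n => by positivity) ?_ h
  filter_upwards [eventually_ge_atTop 1] with n hn
  have hn' : (1 : ℝ) ≤ n := by exact_mod_cast hn
  have h1 : (2 : ℝ) ^ (-(n * δ)) = r ^ n := by
    rw [hr, ← Real.rpow_natCast, ← Real.rpow_mul (by norm_num)]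
    congr 1; ring
  have h2 : (Fintype.card (GridIndex α β n) : ℝ) ≤ (4 * n) ^ (k + 1) := by
    rw [card_gridIndex, ← hk]
    push_cast
    rw [pow_succ (4 * (n : ℝ))]
    refine mul_le_mul (pow_le_pow_left₀ (by positivity) (by linarith) _) (by linarith)
      (by positivity) (by positivity)
  rw [h1]
  calc (Fintype.card (GridIndex α β n) : ℝ) ^ 2 * r ^ n ≤ ((4 * n) ^ (k + 1)) ^ 2 * r ^ n :=
        mul_le_mul_of_nonneg_right (pow_le_pow_left₀ (by positivity) h2 2) (by positivity)
    _ = 4 ^ (2 * k + 2) * ((n : ℝ) ^ (2 * k + 2) * r ^ n) := by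
        rw [← pow_mul, mul_pow, show (k + 1) * 2 = 2 * k + 2 by ring]; ring

lemma tendsto_logb_sq_div (k : ℕ) :
    Tendsto (fun n : ℕ => Real.logb 2 ((n : ℝ) + k) ^ 2 / n) atTop (𝓝 0) := by
  have h0 : Tendsto (fun n : ℕ => (n : ℝ) + k) atTop atTop :=
    tendsto_atTop_add_const_right _ _ tendsto_natCast_atTop_atTop
  have h1 : Tendsto (fun n : ℕ => Real.log ((n : ℝ) + k) ^ 2 / ((n : ℝ) + k)) atTop (𝓝 0) :=
    ((Real.isLittleO_pow_log_id_atTop (n := 2)).tendsto_div_nhds_zero).comp h0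
  have h2 := h1.const_mul ((1 + k) / Real.log 2 ^ 2)
  rw [mul_zero] at h2
  refine squeeze_zero' (Eventually.of_forall fun n => by positivity) ?_ h2
  filter_upwards [eventually_ge_atTop 1] with n hn
  have hn' : (1 : ℝ) ≤ n := by exact_mod_cast hn
  have hl : 0 < Real.log 2 := Real.log_pos (by norm_num)
  have hk : (0 : ℝ) ≤ k := Nat.cast_nonneg k
  have hkn : ((n : ℝ) + k) ≤ (1 + k) * n := by nlinarith
  rw [Real.logb, div_pow, div_div, div_mul_div_comm, div_le_div_iff₀ (by positivity)
    (by positivity)]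
  have h3 : 0 ≤ Real.log ((n : ℝ) + k) ^ 2 * Real.log 2 ^ 2 := by positivity
  nlinarith [mul_le_mul_of_nonneg_left hkn h3]

section
variable {α β : Type*} [Fintype α] [Fintype β]

lemma partialEntropy_le_true_true (P : PMF (α × β)) (u v : Bool) :
    partialEntropy P u v ≤ partialEntropy P true true := by
  refine Finset.sum_le_sum fun z _ => ?_
  rcases (mass_nonneg P z).eq_or_lt with h0 | h0
  · simp [← h0]
  · refine mul_le_mul_of_nonneg_left (neg_le_neg ?_) h0.le
    rw [partialMass_true_true]
    exact Real.logb_le_logb_of_le (by norm_num) h0 (le_partialMass (mass_nonneg P) u v z)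

/-- Direct part with slack `ε`, for a bound `Δ` on the relative delay. -/
lemma eventually_exists_code {S : Set (PMF (α × β))} (hS : S.Nonempty) {D : ℕ → ℤ → Prop}
    {Δ R₁ R₂ : ℝ} (hΔ : 0 ≤ Δ)
    (hD : ∀ η > 0, ∀ᶠ n : ℕ in atTop, ∀ d, D n d → |d| ≤ n ∧ |(d : ℝ)| ≤ n * (Δ + η))
    (hR : ∀ P ∈ S, ∀ u v, (u && v) = false →
      partialEntropy P true true - partialEntropy P u v + Δ * mutualInfo P ≤ freeRate R₁ R₂ u v)
    {ε : ℝ} (hε : 0 < ε) :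
    ∀ᶠ n : ℕ in atTop, ∃ C : Code α β n, C.rate₁ ≤ R₁ + ε ∧ C.rate₂ ≤ R₂ + ε ∧
      ∀ P ∈ S, ∀ d, D n d → C.errorProb P d ≤ ENNReal.ofReal ε := by
  classical
  obtain ⟨P₀, hP₀⟩ := hS
  have : Nonempty (α × β) := ⟨P₀.support_nonempty.some⟩
  set k := Fintype.card (α × β) with hk
  have hl : 0 < Real.log 2 := Real.log_pos (by norm_num)
  have hI0 := mul_nonneg hΔ (mutualInfo_nonneg P₀)
  have hR₁ : 0 ≤ R₁ := by
    have h := hR P₀ hP₀ false true rfl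
    have h2 := partialEntropy_le_true_true P₀ false true
    simp only [freeRate, if_true, Bool.false_eq_true, if_false, add_zero] at h
    linarith
  have hR₂ : 0 ≤ R₂ := by
    have h := hR P₀ hP₀ true false rfl
    have h2 := partialEntropy_le_true_true P₀ true false
    simp only [freeRate, if_true, Bool.false_eq_true, if_false, zero_add] at h
    linarith
  -- `B` bounds the mutual information of all sources; the delay may exceed `n Δ` by `n η`
  set B : ℝ := 2 * (k / Real.log 2) with hB
  have hB0 : 0 ≤ B := by positivity
  set η : ℝ := ε / (16 * (B + 1)) with hη
  have hη0 : 0 < η := by positivity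
  have hηB : η * B ≤ ε / 16 := by
    rw [hη, div_mul_eq_mul_div, div_le_div_iff₀ (by positivity) (by norm_num)]
    nlinarith
  have ht1 : Tendsto (fun n : ℕ => 3 * Real.exp (2 * k) *
      ((Fintype.card (GridIndex α β n) : ℝ) ^ 2 * (2 : ℝ) ^ (-(n * (ε / 4)))) +
      (3 * (2 / (ε / 8) ^ 2)) * (Real.logb 2 ((n : ℝ) + k) ^ 2 / n)) atTop (𝓝 0) := by
    have h := ((tendsto_card_gridIndex_sq_mul α β (show 0 < ε / 4 by positivity)).const_mul
      (3 * Real.exp (2 * k))).add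
      ((tendsto_logb_sq_div k).const_mul (3 * (2 / (ε / 8) ^ 2)))
    simpa only [mul_zero, add_zero] using h
  filter_upwards [hD η hη0, ht1.eventually_le_const hε, eventually_ge_atTop 1,
    tendsto_natCast_atTop_atTop.eventually_ge_atTop (2 / ε),
    tendsto_natCast_atTop_atTop.eventually_ge_atTop (16 * B / ε)] with n hDn herr hn hn2 hnB
  have hn' : (0 : ℝ) < n := by exact_mod_cast hn
  -- slack `ε / 2` in the numbers of codewords and `ε / 4` in the thresholds leaves a factor
  -- `2 ^ (-n ε / 4)` against the polynomial size of the grid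
  set x₁ : ℝ := n * (R₁ + ε / 2) with hx₁
  set x₂ : ℝ := n * (R₂ + ε / 2) with hx₂
  set M₁ := ⌈(2 : ℝ) ^ x₁⌉₊ with hM₁
  set M₂ := ⌈(2 : ℝ) ^ x₂⌉₊ with hM₂
  set N : ℝ := (Fintype.card (GridIndex α β n) : ℝ) with hN
  set κ : ℝ := N * (2 : ℝ) ^ (-(n * (ε / 4))) with hκ
  set K : Bool → Bool → ℝ := fun u v => (2 : ℝ) ^ (n * (freeRate R₁ R₂ u v + ε / 4)) with hKdef
  have hKM : ∀ u v, (u && v) = false → N * K u v ≤ κ * freeCodewords M₁ M₂ u v := by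
    intro u v huv
    have h1 := two_rpow_freeRate_le (Nat.le_ceil ((2 : ℝ) ^ x₁)) (Nat.le_ceil ((2 : ℝ) ^ x₂)) u v
    have h2 : n * (freeRate R₁ R₂ u v + ε / 4) ≤ -(n * (ε / 4)) + freeRate x₁ x₂ u v := by
      have : 0 < n * ε := by positivity
      simp only [freeRate, hx₁, hx₂]
      rcases u with _ | _ <;> rcases v with _ | _ <;> simp at huv ⊢ <;> nlinarith
    rw [hκ, mul_assoc]
    refine mul_le_mul_of_nonneg_left ?_ (Nat.cast_nonneg _)
    calc K u v ≤ (2 : ℝ) ^ (-(n * (ε / 4)) + freeRate x₁ x₂ u v) :=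
          Real.rpow_le_rpow_of_exponent_le (by norm_num) h2
      _ ≤ _ := by
          rw [Real.rpow_add (by norm_num)]
          exact mul_le_mul_of_nonneg_left h1 (by positivity)
  obtain ⟨C, hC₁, hC₂, hC⟩ := exists_universal_code (α := α) (β := β) hn
    (Nat.ceil_pos.2 (by positivity) : 0 < M₁) (Nat.ceil_pos.2 (by positivity) : 0 < M₂)
    (κ := κ) (by positivity) K (fun u v => by positivity) hKM
  have hrate : ∀ R : ℝ, 0 ≤ R → Real.logb 2 (⌈(2 : ℝ) ^ (n * (R + ε / 2))⌉₊ : ℝ) / n ≤ R + ε := by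
    intro R hR
    rw [div_le_iff₀ hn']
    refine (logb_ceil_le (by positivity)).trans ?_
    rw [div_le_iff₀ hε] at hn2
    nlinarith
  refine ⟨C, ?_, ?_, fun P hP d hd => ?_⟩
  · rw [Code.rate₁, hC₁]; exact hrate R₁ hR₁
  · rw [Code.rate₂, hC₂]; exact hrate R₂ hR₂
  obtain ⟨hdn, hdΔ⟩ := hDn d hd
  obtain ⟨Q, hPQ, hQ, hle⟩ := hC P d hdn
  refine hle.trans (ENNReal.ofReal_le_ofReal (le_trans ?_ herr))
  have hc : (1 : ℝ) ≤ 1 + k / n := by linarith [show (0 : ℝ) ≤ k / n by positivity]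
  have hlogc : 2 * n * Real.logb 2 (1 + k / n) ≤ B := by
    have h1 : Real.log (1 + k / n) ≤ k / n := by
      linarith [Real.log_le_sub_one_of_pos (show (0 : ℝ) < 1 + k / n by linarith)]
    calc 2 * n * Real.logb 2 (1 + k / n) = 2 * n / Real.log 2 * Real.log (1 + k / n) := by
          rw [Real.logb]; ring
      _ ≤ 2 * n / Real.log 2 * (k / n) := mul_le_mul_of_nonneg_left h1 (by positivity)
      _ = B := by rw [hB]; field_simp
  have hnB' : B ≤ n * (ε / 16) := by
    rw [div_le_iff₀ hε] at hnB; linarith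
  have hcheb : ∀ u v, (u && v) = false →
      sourceProb P {ω | Real.logb 2 (K u v) < ∑ t ∈ window n d, letterInfo Q n d u v t (ω t)} ≤
        (2 / (ε / 8) ^ 2) * (Real.logb 2 ((n : ℝ) + k) ^ 2 / n) := by
    intro u v huv
    refine (sourceProb_letterInfo_le P hc (by positivity) hPQ hQ hdn huv
      (a := n * (ε / 8)) (by positivity) ?_).trans (le_of_eq ?_)
    · rw [hKdef, Real.logb_rpow (by norm_num) (by norm_num)]
      have h1 := mul_le_mul_of_nonneg_left (hR P hP u v huv) hn'.le
      have h2 : |(d : ℝ)| * mutualInfo P ≤ n * (Δ * mutualInfo P) + n * (ε / 16) := by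
        calc |(d : ℝ)| * mutualInfo P ≤ n * (Δ + η) * mutualInfo P :=
              mul_le_mul_of_nonneg_right hdΔ (mutualInfo_nonneg P)
          _ = n * (Δ * mutualInfo P) + n * (η * mutualInfo P) := by ring
          _ ≤ n * (Δ * mutualInfo P) + n * (η * B) := by
              have := mutualInfo_le P
              gcongr
          _ ≤ _ := by gcongr
      linarith
    · rw [← hk]; field_simp
  have hexp : (1 + (k : ℝ) / n) ^ (2 * n) ≤ Real.exp (2 * k) := by
    calc (1 + (k : ℝ) / n) ^ (2 * n) ≤ Real.exp (k / n) ^ (2 * n) :=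
          pow_le_pow_left₀ (by positivity) (by linarith [Real.add_one_le_exp ((k : ℝ) / n)]) _
      _ = Real.exp (2 * k) := by
          rw [← Real.exp_nat_mul]; congr 1; push_cast; field_simp
  have h1 := hcheb true false rfl
  have h2 := hcheb false true rfl
  have h3 := hcheb false false rfl
  refine add_le_add ?_ (by linarith)
  calc (1 + (k : ℝ) / n) ^ (2 * n) * (3 * κ * N) ≤ Real.exp (2 * k) * (3 * κ * N) :=
        mul_le_mul_of_nonneg_right hexp (by positivity)
    _ = _ := by rw [hκ]; ring

end

/-! ### From slack to no slack -/

/-- If objects of quality `m` exist for all large `n`, whatever `m` is, then a single sequence of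
objects eventually has every quality. -/
lemma exists_seq_of_eventually {γ : ℕ → Type*} [∀ n, Nonempty (γ n)] {p : ℕ → ∀ n, γ n → Prop}
    (hmono : ∀ {m m' n c}, m ≤ m' → p m' n c → p m n c) (h : ∀ m, ∀ᶠ n in atTop, ∃ c, p m n c) :
    ∃ c : ∀ n, γ n, ∀ m, ∀ᶠ n in atTop, p m n (c n) := by
  classical
  -- the best quality among `0, …, n` that is attained at `n`
  let q : ℕ → ℕ := fun n => Nat.findGreatest (fun m => ∃ c, p m n c) n
  refine ⟨fun n => if hq : ∃ c, p (q n) n c then hq.choose else Classical.arbitrary _, fun m => ?_⟩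
  filter_upwards [h m, eventually_ge_atTop m] with n hn hmn
  have hq : ∃ c, p (q n) n c := Nat.findGreatest_spec (P := fun m => ∃ c, p m n c) hmn hn
  rw [dif_pos hq]
  exact hmono (Nat.le_findGreatest hmn hn) hq.choose_spec

section
variable {α β : Type*}

instance [Nonempty (α × β)] (n : ℕ) : Nonempty (Code α β n) := by
  obtain ⟨x, y⟩ := ‹Nonempty (α × β)›
  exact ⟨⟨1, 1, one_pos, one_pos, fun _ => 0, fun _ => 0, fun _ => (fun _ => x, fun _ => y)⟩⟩

lemma limsup_coe_le {a : ℕ → ℝ} {R : ℝ} (h : ∀ ε > 0, ∀ᶠ n in atTop, a n ≤ R + ε) :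
    limsup (fun n => (a n : EReal)) atTop ≤ (R : EReal) := by
  rw [← EReal.le_of_forall_lt_iff_le]
  intro z hz
  rw [EReal.coe_lt_coe_iff] at hz
  refine limsup_le_of_le (by isBoundedDefault) ?_
  filter_upwards [h (z - R) (by linarith)] with n hn
  exact EReal.coe_le_coe_iff.2 (by linarith)

lemma eventually_le_of_limsup_coe_le {a : ℕ → ℝ} {R : ℝ}
    (h : limsup (fun n => (a n : EReal)) atTop ≤ (R : EReal)) {ε : ℝ} (hε : 0 < ε) :
    ∀ᶠ n in atTop, a n ≤ R + ε := by
  have h1 : limsup (fun n => (a n : EReal)) atTop < ((R + ε : ℝ) : EReal) :=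
    h.trans_lt (EReal.coe_lt_coe_iff.2 (by linarith))
  filter_upwards [eventually_lt_of_limsup_lt h1 (by isBoundedDefault)] with n hn
  exact (EReal.coe_lt_coe_iff.1 hn).le

/-- Codes for every slack `ε` combine to one sequence of codes without slack. -/
lemma achievable_of_eventually_exists_code [Nonempty (α × β)] {S : Set (PMF (α × β))}
    {dmin dmax : ℕ → ℤ} {R₁ R₂ : ℝ}
    (h : ∀ ε > 0, ∀ᶠ n : ℕ in atTop, ∃ C : Code α β n, C.rate₁ ≤ R₁ + ε ∧ C.rate₂ ≤ R₂ + ε ∧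
      ∀ P ∈ S, ∀ d, d ∈ Set.Icc (dmin n) (dmax n) → C.errorProb P d ≤ ENNReal.ofReal ε) :
    Achievable S dmin dmax R₁ R₂ := by
  obtain ⟨C, hC⟩ := exists_seq_of_eventually (γ := fun n => Code α β n)
    (p := fun m n C => C.rate₁ ≤ R₁ + 1 / ((m : ℝ) + 1) ∧ C.rate₂ ≤ R₂ + 1 / ((m : ℝ) + 1) ∧
      ∀ P ∈ S, ∀ d, d ∈ Set.Icc (dmin n) (dmax n) →
        C.errorProb P d ≤ ENNReal.ofReal (1 / ((m : ℝ) + 1)))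
    (by
      intro m m' n C hm hC
      have h1 : 1 / ((m' : ℝ) + 1) ≤ 1 / ((m : ℝ) + 1) := Nat.one_div_le_one_div hm
      exact ⟨by linarith [hC.1], by linarith [hC.2.1],
        fun P hP d hd => (hC.2.2 P hP d hd).trans (ENNReal.ofReal_le_ofReal h1)⟩)
    (fun m => h _ (by positivity))
  refine ⟨C, limsup_coe_le fun ε hε => ?_, limsup_coe_le fun ε hε => ?_, ?_⟩
  · obtain ⟨m, hm⟩ := exists_nat_one_div_lt hε
    filter_upwards [hC m] with n hn
    linarith [hn.1]
  · obtain ⟨m, hm⟩ := exists_nat_one_div_lt hε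
    filter_upwards [hC m] with n hn
    linarith [hn.2.1]
  · rw [ENNReal.tendsto_nhds_zero]
    intro ε hε
    obtain ⟨r, hr, hrε⟩ := ENNReal.lt_iff_exists_nnreal_btwn.1 hε
    obtain ⟨m, hm⟩ := exists_nat_one_div_lt (show (0 : ℝ) < r by exact_mod_cast hr)
    filter_upwards [hC m] with n hn
    refine iSup₂_le fun P hP => iSup₂_le fun d hd => ((hn.2.2 P hP d hd).trans ?_).trans hrε.le
    exact ENNReal.ofReal_le_of_le_toReal (by simpa using hm.le)

/-! ### Asymptotics: the converse part -/

lemma freeCodewords_le {M₁ M₂ : ℕ} {x₁ x₂ : ℝ} (h₁ : (M₁ : ℝ) ≤ 2 ^ x₁)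
    (h₂ : (M₂ : ℝ) ≤ 2 ^ x₂) (u v : Bool) :
    (freeCodewords M₁ M₂ u v : ℝ) ≤ (2 : ℝ) ^ freeRate x₁ x₂ u v := by
  rw [freeRate, Real.rpow_add (by norm_num), freeCodewords, Nat.cast_mul]
  refine mul_le_mul ?_ ?_ (by positivity) (by positivity)
  · cases u <;> simp [h₁]
  · cases v <;> simp [h₂]

variable [Fintype α] [Fintype β]

/-- A code with too few codewords fails: only blocks whose information density is atypically
small can be recovered in addition to (number of codewords) `/ 2 ^ x` of the probability. -/
lemma one_le_errorProb_add (P : PMF (α × β)) {L : ℝ}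
    (hL : ∀ n d u v t z, |letterInfo P n d u v t z| ≤ L) {n : ℕ} {d : ℤ} (hd : |d| ≤ n)
    {u v : Bool} (huv : (u && v) = false) (C : Code α β n) {a x : ℝ} (ha : 0 < a)
    (hx : x + a ≤
      n * (partialEntropy P true true - partialEntropy P u v) + |(d : ℝ)| * mutualInfo P) :
    1 ≤ (C.errorProb P d).toReal + freeCodewords C.M₁ C.M₂ u v / 2 ^ x +
      2 * n * L ^ 2 / a ^ 2 := by
  classical
  set E := {ω | C.dec (C.enc₁ (block n d ω).1, C.enc₂ (block n d ω).2) ≠ block n d ω} with hE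
  set s : Finset ((Fin n → α) × (Fin n → β)) := Finset.univ.filter fun z =>
    C.dec (C.enc₁ z.1, C.enc₂ z.2) = z ∧
      2 ^ x * blockLaw P n d z ≤ partialMass (blockLaw P n d) u v z with hs
  have hmean : ∑ t ∈ window n d, ∑ z, mass P z * letterInfo P n d u v t z =
      n * (partialEntropy P true true - partialEntropy P u v) + |(d : ℝ)| * mutualInfo P := by
    rw [← sum_window_partialEntropy P n d hd huv]
    exact Finset.sum_congr rfl fun t _ => sum_mass_mul_letterInfo P n d u v t
  have hcover : (Set.univ : Set (ℤ → α × β)) ⊆ (E ∪ {ω | block n d ω ∈ s}) ∪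
      {ω | a ≤ |∑ t ∈ window n d, letterInfo P n d u v t (ω t) -
        ∑ t ∈ window n d, ∑ z, mass P z * letterInfo P n d u v t z|} := by
    intro ω _
    by_cases h1 : C.dec (C.enc₁ (block n d ω).1, C.enc₂ (block n d ω).2) = block n d ω
    · by_cases h2 : 2 ^ x * blockLaw P n d (block n d ω) ≤
          partialMass (blockLaw P n d) u v (block n d ω)
      · exact Or.inl (Or.inr (Finset.mem_filter.2 ⟨Finset.mem_univ _, h1, h2⟩))
      · right
        rw [not_le] at h2
        have hpm := partialMass_nonneg (blockLaw_nonneg P n d) u v (block n d ω)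
        have hp : 0 < blockLaw P n d (block n d ω) :=
          pos_of_mul_pos_right (hpm.trans_lt h2) (by positivity)
        have hpm' := hp.trans_le (le_partialMass (blockLaw_nonneg P n d) u v (block n d ω))
        have h3 : ∑ t ∈ window n d, letterInfo P n d u v t (ω t) < x := by
          rw [sum_letterInfo P n d u v ω (div_pos hp hpm').ne', ← Real.logb_inv, inv_div,
            Real.logb_lt_iff_lt_rpow (by norm_num) (div_pos hpm' hp)]
          exact (div_lt_iff₀ hp).2 h2
        change a ≤ |_ - _|
        rw [hmean]
        refine le_trans ?_ (neg_le_abs _)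
        linarith
    · exact Or.inl (Or.inl h1)
  have herr : (C.errorProb P d).toReal = sourceProb P E := by
    rw [errorProb_eq, ENNReal.toReal_ofReal (sourceProb_nonneg _ _)]
  have hcor : sourceProb P {ω | block n d ω ∈ s} ≤ freeCodewords C.M₁ C.M₂ u v / 2 ^ x := by
    rw [sourceProb_block]
    exact sum_correct_le C.enc₁ C.enc₂ C.dec (blockLaw_nonneg P n d) (sum_blockLaw P n d) u v
      (by positivity) s fun z hz => (Finset.mem_filter.1 hz).2
  have hcheb := sourceProb_chebyshev P (window n d) (letterInfo P n d u v) (hL n d u v) ha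
  have hcard : ((window n d).card : ℝ) * L ^ 2 / a ^ 2 ≤ 2 * n * L ^ 2 / a ^ 2 := by
    have : ((window n d).card : ℝ) ≤ 2 * n := by exact_mod_cast card_window_le n d
    gcongr
  have h1 := sourceProb_mono P hcover
  rw [sourceProb_univ] at h1
  have h2 := sourceProb_union_le P (E ∪ {ω | block n d ω ∈ s})
    {ω | a ≤ |∑ t ∈ window n d, letterInfo P n d u v t (ω t) -
        ∑ t ∈ window n d, ∑ z, mass P z * letterInfo P n d u v t z|}
  have h3 := sourceProb_union_le P E {ω | block n d ω ∈ s}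
  linarith

/-- Converse for a single source `P`: codes with vanishing error probability need the rates of
the region, where `Δ` is attained by the relative delays `d n / n` infinitely often up to any
`η`. -/
lemma le_freeRate_of_codes {P : PMF (α × β)} {Δ R₁ R₂ : ℝ} (C : ∀ n, Code α β n)
    (h₁ : ∀ ε > 0, ∀ᶠ n in atTop, (C n).rate₁ ≤ R₁ + ε)
    (h₂ : ∀ ε > 0, ∀ᶠ n in atTop, (C n).rate₂ ≤ R₂ + ε) (d : ℕ → ℤ)
    (herr : Tendsto (fun n => ((C n).errorProb P (d n)).toReal) atTop (𝓝 0))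
    (hd : ∀ᶠ n : ℕ in atTop, |d n| ≤ n)
    (hΔ : ∀ η > 0, ∃ᶠ n : ℕ in atTop, n * (Δ - η) ≤ |(d n : ℝ)|) {u v : Bool}
    (huv : (u && v) = false) :
    partialEntropy P true true - partialEntropy P u v + Δ * mutualInfo P ≤ freeRate R₁ R₂ u v := by
  by_contra! hlt
  obtain ⟨L, hL⟩ := exists_abs_letterInfo_le P
  set H := partialEntropy P true true - partialEntropy P u v with hH
  set I := mutualInfo P with hI
  have hI0 : 0 ≤ I := mutualInfo_nonneg P
  -- the gap `γ` is split among the delay, the rates, the typicality and the final exponent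
  set γ := H + Δ * I - freeRate R₁ R₂ u v with hγ
  have hγ0 : 0 < γ := by rw [hγ]; linarith
  set η := γ / (8 * (I + 1)) with hη
  have hη0 : 0 < η := by positivity
  have hηI : η * I ≤ γ / 8 := by
    rw [hη, div_mul_eq_mul_div, div_le_div_iff₀ (by positivity) (by norm_num)]
    nlinarith
  have ht1 : Tendsto (fun n : ℕ => ((2 : ℝ) ^ (-(γ / 2))) ^ n) atTop (𝓝 0) :=
    tendsto_pow_atTop_nhds_zero_of_lt_one (by positivity)
      (Real.rpow_lt_one_of_one_lt_of_neg (by norm_num) (by linarith))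
  have ht2 : Tendsto (fun n : ℕ => 2 * L ^ 2 / (γ / 8) ^ 2 / (n : ℝ)) atTop (𝓝 0) :=
    tendsto_const_div_atTop_nhds_zero_nat _
  have hev := (((((h₁ (γ / 16) (by positivity)).and (h₂ (γ / 16) (by positivity))).and hd).and
    (herr.eventually_lt_const (show (0 : ℝ) < 1 / 4 by norm_num))).and
    (ht1.eventually_lt_const (show (0 : ℝ) < 1 / 4 by norm_num))).and
    (ht2.eventually_lt_const (show (0 : ℝ) < 1 / 4 by norm_num))
  obtain ⟨n, hfr, ⟨⟨⟨⟨⟨hr₁, hr₂⟩, hdn⟩, he⟩, hp⟩, hc⟩, hn⟩ :=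
    ((hΔ η hη0).and_eventually (hev.and (eventually_ge_atTop 1))).exists
  have hn' : (0 : ℝ) < n := by exact_mod_cast hn
  have hone := one_le_errorProb_add P hL hdn huv (C n) (a := n * (γ / 8))
    (x := n * (H + Δ * I - γ / 4)) (by positivity) (by
      have h1 := mul_le_mul_of_nonneg_right hfr hI0
      have h2 := mul_le_mul_of_nonneg_left hηI hn'.le
      rw [← hH, ← hI]
      nlinarith)
  have hM : ∀ {M : ℕ} {R : ℝ}, 0 < M → Real.logb 2 M / n ≤ R + γ / 16 →
      (M : ℝ) ≤ 2 ^ (n * (R + γ / 16)) := by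
    intro M R hM0 h
    rw [div_le_iff₀ hn'] at h
    rw [← Real.logb_le_iff_le_rpow (by norm_num) (by exact_mod_cast hM0)]
    linarith
  have hfree := freeCodewords_le (hM (C n).M₁_pos hr₁) (hM (C n).M₂_pos hr₂) u v
  have hexp : freeRate (n * (R₁ + γ / 16)) (n * (R₂ + γ / 16)) u v ≤
      n * (H + Δ * I - γ / 4) + -(γ / 2) * n := by
    have h1 : freeRate (n * (R₁ + γ / 16)) (n * (R₂ + γ / 16)) u v ≤
        n * (freeRate R₁ R₂ u v + γ / 8) := by
      have : 0 < n * γ := by positivity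
      simp only [freeRate]
      rcases u with _ | _ <;> rcases v with _ | _ <;> simp at huv ⊢ <;> nlinarith
    have h2 : freeRate R₁ R₂ u v = H + Δ * I - γ := by rw [hγ]; ring
    rw [h2] at h1
    have : 0 < n * γ := by positivity
    nlinarith
  have hfrac : (freeCodewords (C n).M₁ (C n).M₂ u v : ℝ) / 2 ^ (n * (H + Δ * I - γ / 4)) ≤
      ((2 : ℝ) ^ (-(γ / 2))) ^ n := by
    rw [div_le_iff₀ (by positivity), ← Real.rpow_natCast, ← Real.rpow_mul (by norm_num), mul_comm,
      ← Real.rpow_add (by norm_num)]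
    exact hfree.trans (Real.rpow_le_rpow_of_exponent_le (by norm_num) hexp)
  have hcheb : 2 * n * L ^ 2 / (n * (γ / 8)) ^ 2 = 2 * L ^ 2 / (γ / 8) ^ 2 / (n : ℝ) := by
    field_simp
  rw [hcheb] at hone
  linarith

end

/-! ### The maximal relative delay -/

lemma delayRatio_isBoundedUnder {dmin dmax : ℕ → ℤ}
    (hd : ∀ n : ℕ, 1 ≤ n → -(n : ℤ) ≤ dmin n ∧ dmin n ≤ dmax n ∧ dmax n ≤ (n : ℤ)) :
    IsBoundedUnder (· ≤ ·) atTop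
      fun n : ℕ => max |(dmax n : ℝ)| |(dmin n : ℝ)| / (n : ℝ) := by
  refine isBoundedUnder_of_eventually_le (a := 1) ?_
  filter_upwards [eventually_ge_atTop 1] with n hn
  obtain ⟨h1, h2, h3⟩ := hd n hn
  have hn' : (0 : ℝ) < n := by exact_mod_cast hn
  rw [div_le_one hn', max_le_iff, abs_le, abs_le]
  refine ⟨⟨?_, ?_⟩, ⟨?_, ?_⟩⟩
  · exact_mod_cast h1.trans h2
  · exact_mod_cast h3
  · exact_mod_cast h1
  · exact_mod_cast h2.trans h3

lemma delayRatio_isCoboundedUnder (dmin dmax : ℕ → ℤ) :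
    IsCoboundedUnder (· ≤ ·) atTop
      fun n : ℕ => max |(dmax n : ℝ)| |(dmin n : ℝ)| / (n : ℝ) :=
  (isBoundedUnder_of_eventually_ge (a := 0)
    (Eventually.of_forall fun n => by positivity)).isCoboundedUnder_le

lemma delayRatio_nonneg {dmin dmax : ℕ → ℤ}
    (hd : ∀ n : ℕ, 1 ≤ n → -(n : ℤ) ≤ dmin n ∧ dmin n ≤ dmax n ∧ dmax n ≤ (n : ℤ)) :
    0 ≤ delayRatio dmin dmax :=
  le_limsup_of_frequently_le (Eventually.of_forall fun n => by positivity).frequently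
    (delayRatio_isBoundedUnder hd)

/-- Eventually all admissible delays are at most `n (Δ + η)`. -/
lemma eventually_abs_delay_le {dmin dmax : ℕ → ℤ}
    (hd : ∀ n : ℕ, 1 ≤ n → -(n : ℤ) ≤ dmin n ∧ dmin n ≤ dmax n ∧ dmax n ≤ (n : ℤ))
    {η : ℝ} (hη : 0 < η) : ∀ᶠ n : ℕ in atTop, ∀ d, d ∈ Set.Icc (dmin n) (dmax n) →
      |d| ≤ n ∧ |(d : ℝ)| ≤ n * (delayRatio dmin dmax + η) := by
  have h : limsup (fun n : ℕ => max |(dmax n : ℝ)| |(dmin n : ℝ)| / (n : ℝ)) atTop <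
      delayRatio dmin dmax + η := lt_add_of_pos_right _ hη
  filter_upwards [eventually_lt_of_limsup_lt h (delayRatio_isBoundedUnder hd),
    eventually_ge_atTop 1] with n hn hn1 d hdn
  have hn' : (0 : ℝ) < n := by exact_mod_cast hn1
  obtain ⟨h1, h2, h3⟩ := hd n hn1
  refine ⟨abs_le.2 ⟨h1.trans hdn.1, hdn.2.trans h3⟩, ?_⟩
  rw [div_lt_iff₀ hn'] at hn
  have h4 : |(d : ℝ)| ≤ max |(dmax n : ℝ)| |(dmin n : ℝ)| := by
    rw [max_comm]
    exact abs_le_max_abs_abs (by exact_mod_cast hdn.1) (by exact_mod_cast hdn.2)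
  linarith

/-- The extreme delay of larger modulus is infinitely often at least `n (Δ - η)`. -/
lemma frequently_le_abs_delay {dmin dmax d : ℕ → ℤ}
    (hdd : ∀ n, |(d n : ℝ)| = max |(dmax n : ℝ)| |(dmin n : ℝ)|) {η : ℝ} (hη : 0 < η) :
    ∃ᶠ n : ℕ in atTop, n * (delayRatio dmin dmax - η) ≤ |(d n : ℝ)| := by
  have h : delayRatio dmin dmax - η <
      limsup (fun n : ℕ => max |(dmax n : ℝ)| |(dmin n : ℝ)| / (n : ℝ)) atTop :=
    sub_lt_self _ hη
  refine ((frequently_lt_of_lt_limsup (delayRatio_isCoboundedUnder dmin dmax) h).and_eventually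
    (eventually_ge_atTop 1)).mono ?_
  rintro n ⟨hn, hn1⟩
  have hn' : (0 : ℝ) < n := by exact_mod_cast hn1
  rw [lt_div_iff₀ hn'] at hn
  rw [hdd]; linarith

section
variable {α β : Type*} [Fintype α] [Fintype β]

/-- The three entropy conditions for a source, one for each side information. -/
lemma forall_freeRate_iff (P : PMF (α × β)) (Δ R₁ R₂ : ℝ) :
    (∀ u v, (u && v) = false →
      partialEntropy P true true - partialEntropy P u v + Δ * mutualInfo P ≤ freeRate R₁ R₂ u v) ↔
    condEntropyXY P + Δ * mutualInfo P ≤ R₁ ∧ condEntropyYX P + Δ * mutualInfo P ≤ R₂ ∧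
      jointEntropy P + Δ * mutualInfo P ≤ R₁ + R₂ := by
  rw [condEntropyXY_eq, condEntropyYX_eq, jointEntropy_eq]
  constructor
  · intro h
    exact ⟨by simpa [freeRate] using h false true rfl, by simpa [freeRate] using h true false rfl,
      by simpa [freeRate, partialEntropy_false_false] using h false false rfl⟩
  · rintro ⟨h1, h2, h3⟩ u v huv
    rcases u with _ | _ <;> rcases v with _ | _
    · simpa [freeRate, partialEntropy_false_false] using h3
    · simpa [freeRate] using h1
    · simpa [freeRate] using h2
    · simp at huv

/-- The coding theorem in terms of partial entropies, one inequality for each choice of side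
information. -/
theorem achievable_iff {S : Set (PMF (α × β))} (hS : S.Nonempty) {dmin dmax : ℕ → ℤ}
    (hd : ∀ n : ℕ, 1 ≤ n → -(n : ℤ) ≤ dmin n ∧ dmin n ≤ dmax n ∧ dmax n ≤ (n : ℤ)) (R₁ R₂ : ℝ) :
    Achievable S dmin dmax R₁ R₂ ↔ ∀ P ∈ S, ∀ u v, (u && v) = false →
      partialEntropy P true true - partialEntropy P u v + delayRatio dmin dmax * mutualInfo P ≤
        freeRate R₁ R₂ u v := by
  constructor
  · rintro ⟨C, h₁, h₂, herr⟩ P hP u v huv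
    let d : ℕ → ℤ := fun n => if |dmin n| ≤ |dmax n| then dmax n else dmin n
    have hdd : ∀ n, |(d n : ℝ)| = max |(dmax n : ℝ)| |(dmin n : ℝ)| := by
      intro n
      by_cases h : |dmin n| ≤ |dmax n|
      · have h' : |(dmin n : ℝ)| ≤ |(dmax n : ℝ)| := by exact_mod_cast h
        simp only [d, if_pos h, max_eq_left h']
      · have h' : |(dmax n : ℝ)| ≤ |(dmin n : ℝ)| := by exact_mod_cast (not_le.1 h).le
        simp only [d, if_neg h, max_eq_right h']
    have hmem : ∀ n, 1 ≤ n → d n ∈ Set.Icc (dmin n) (dmax n) := by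
      intro n hn
      obtain ⟨-, h, -⟩ := hd n hn
      by_cases h' : |dmin n| ≤ |dmax n|
      · simp only [d, if_pos h']; exact ⟨h, le_rfl⟩
      · simp only [d, if_neg h']; exact ⟨le_rfl, h⟩
    have h0 : Tendsto (fun n => (C n).errorProb P (d n)) atTop (𝓝 0) := by
      refine tendsto_of_tendsto_of_tendsto_of_le_of_le' tendsto_const_nhds herr
        (Eventually.of_forall fun n => zero_le) ?_
      filter_upwards [eventually_ge_atTop 1] with n hn
      exact le_iSup₂_of_le P hP (le_iSup₂_of_le (d n) (hmem n hn) le_rfl)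
    refine le_freeRate_of_codes C (fun ε hε => eventually_le_of_limsup_coe_le h₁ hε)
      (fun ε hε => eventually_le_of_limsup_coe_le h₂ hε) d ?_ ?_
      (fun η hη => frequently_le_abs_delay hdd hη) huv
    · have h := (ENNReal.tendsto_toReal ENNReal.zero_ne_top).comp h0
      rwa [ENNReal.toReal_zero] at h
    · filter_upwards [eventually_ge_atTop 1] with n hn
      obtain ⟨h1, -, h3⟩ := hd n hn
      exact abs_le.2 ⟨h1.trans (hmem n hn).1, (hmem n hn).2.trans h3⟩
  · intro hR
    obtain ⟨P₀, hP₀⟩ := hS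
    have : Nonempty (α × β) := ⟨P₀.support_nonempty.some⟩
    exact achievable_of_eventually_exists_code fun ε hε =>
      eventually_exists_code ⟨P₀, hP₀⟩ (D := fun n d => d ∈ Set.Icc (dmin n) (dmax n))
        (delayRatio_nonneg hd) (fun η hη => eventually_abs_delay_le hd hη) hR hε

end

end

end AsyncSW

theorem theorem1 {α β : Type*} [Fintype α] [Fintype β]
    (S : Set (PMF (α × β))) (hS : S.Nonempty) (dmin dmax : ℕ → ℤ)
    (hd : ∀ n : ℕ, 1 ≤ n →
      -(n : ℤ) ≤ dmin n ∧ dmin n ≤ dmax n ∧ dmax n ≤ (n : ℤ)) :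
    AsyncSW.achievableRateRegion S dmin dmax =
      {R : ℝ × ℝ |
        (⨆ P ∈ S, ((AsyncSW.condEntropyXY P
            + AsyncSW.delayRatio dmin dmax * AsyncSW.mutualInfo P : ℝ) : EReal))
          ≤ (R.1 : EReal) ∧
        (⨆ P ∈ S, ((AsyncSW.condEntropyYX P
            + AsyncSW.delayRatio dmin dmax * AsyncSW.mutualInfo P : ℝ) : EReal))
          ≤ (R.2 : EReal) ∧
        (⨆ P ∈ S, ((AsyncSW.jointEntropy P
            + AsyncSW.delayRatio dmin dmax * AsyncSW.mutualInfo P : ℝ) : EReal))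
          ≤ ((R.1 + R.2 : ℝ) : EReal)} := by
  ext ⟨R₁, R₂⟩
  change AsyncSW.Achievable S dmin dmax R₁ R₂ ↔ _
  rw [AsyncSW.achievable_iff hS hd]
  simp only [AsyncSW.forall_freeRate_iff, Set.mem_ofPred_eq, iSup₂_le_iff, EReal.coe_le_coe_iff]
  exact ⟨fun h => ⟨fun P hP => (h P hP).1, fun P hP => (h P hP).2.1, fun P hP => (h P hP).2.2⟩,
    fun h P hP => ⟨h.1 P hP, h.2.1 P hP, h.2.2 P hP⟩⟩
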